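/- Let $G$ be a group and $t_1,\dots,t_r\in G$ involutions; for $J\subseteq\{1,\dots,r\}$ put $G_J=\langle t_j : j\in J\rangle$ (so $G_\emptyset=1$), writing $G_{j_1\cdots j_k}$ for $G_{\{j_1,\dots,j_k\}}$. Then $\{t_1,\dots,t_r\}$ is a C-string of rank $r$ for $G$ if (i) $G=\langle t_1,\dots,t_r\rangle$, (ii) $t_i$ and $t_j$ commute whenever $|i-j|\ge 2$, and (iii) $G_J\cap G_K=G_{J\cap K}$ for all $J,K\subseteq\{1,\dots,r\}$. Its Schläfli symbol is $[p_1,\dots,p_{r-1}]$, where $p_i$ is the order of $t_it_{i+1}$. A C-string of rank $r$ for $G$ is unravelled if, for every normal subgroup $N$ of $G$ with $1\ne N\ne G$, the images $\bar t_1,\dots,\bar t_r$ of $t_1,\dots,t_r$ in $G/N$ either are not pairwise distinct, or are pairwise distinct but do not form a C-string for $G/N$. **Theorem.** Let $n\ge 5$ be odd, and let $\mathrm{B}_n$ be the Coxeter group of type $\mathrm B_n$. In $\mathrm{Sym}(2n)$, the symmetric group on $\{1,\dots,2n\}$, put $$t_1=\prod_{i=0}^{\lfloor (n-2)/2\rfloor}(1+2i,\,2+2i)(n+1+2i,\,n+2+2i),$$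 $$t_2=\prod_{i=1}^{\lfloor (n-3)/2\rfloor}(2+2i,\,3+2i)(n+2+2i,\,n+3+2i),$$ $$t_3=(1,3)(2,4)(n+1,n+3)(n+2,n+4),$$ $$t_4=(1,2)(n+1,n+2)\prod_{i=1}^{n-2}(2+i,\,n+2+i).$$ Then $G=\langle t_1,t_2,t_3,t_4\rangle$ is isomorphic to $\mathrm B_n$, and $\{t_1,t_2,t_3,t_4\}$ is a C-string of rank $4$ for $G$ with Schläfli symbol $[2n-4,\,6,\,4]$. Moreover $G_{123}\cong\mathrm{Sym}(n)$ and $G_{234}\cong\mathbb Z_2\times\mathrm{Sym}(5)$. If $n>5$, this C-string is unravelled. -/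

import Mathlib

/-- For a family `t` of elements of a group and a set `J` of indices, the subgroup `G_J`
generated by the `t j` with `j ∈ J` (the trivial subgroup when `J` is empty). -/
def subgroupOn {G : Type*} [Group G] {r : ℕ} (t : Fin r → G) (J : Set (Fin r)) : Subgroup G :=
  Subgroup.closure (t '' J)

/-- `t 0, …, t (r - 1)` is a C-string of rank `r` for the group `G`. The `t i` are pairwise
distinct automatically: for `i ≠ j` the intersection property gives `G_{i} ∩ G_{j} = 1`. -/
structure IsCString {G : Type*} [Group G] {r : ℕ} (t : Fin r → G) : Prop where
  /-- Every `t i` is an involution. -/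
  involution : ∀ i, orderOf (t i) = 2
  /-- The `t i` generate `G`. -/
  generates : Subgroup.closure (Set.range t) = ⊤
  /-- `t i` and `t j` commute whenever `|i - j| ≥ 2`. -/
  commute : ∀ i j : Fin r, 2 ≤ |((i : ℕ) : ℤ) - ((j : ℕ) : ℤ)| → Commute (t i) (t j)
  /-- The intersection property. -/
  inter : ∀ J K : Set (Fin r), subgroupOn t J ⊓ subgroupOn t K = subgroupOn t (J ∩ K)

/-- The string `t` has Schläfli symbol `[p 0, …, p (r - 1)]`: `p i` is the order of the product
of the `i`-th and the `(i + 1)`-st element. -/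
def HasSchlafliSymbol {G : Type*} [Group G] {r : ℕ} (t : Fin (r + 1) → G) (p : Fin r → ℕ) : Prop :=
  ∀ i : Fin r, orderOf (t i.castSucc * t i.succ) = p i

/-- The C-string `t` is `N`-unravelled: its image in `G ⧸ N` has fewer than `r` elements, or it
has `r` elements but is not a C-string for `G ⧸ N`. -/
def IsUnravelledAt {G : Type*} [Group G] {r : ℕ} (t : Fin r → G) (N : Subgroup G) [N.Normal] :
    Prop :=
  (Set.range fun i => (t i : G ⧸ N)).ncard < r ∨
    ((Set.range fun i => (t i : G ⧸ N)).ncard = r ∧ ¬ IsCString fun i => (t i : G ⧸ N))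

/-- `t` is an unravelled C-string for `G`. -/
def IsUnravelledCString {G : Type*} [Group G] {r : ℕ} (t : Fin r → G) : Prop :=
  IsCString t ∧
    ∀ (N : Subgroup G) [N.Normal], N ≠ ⊥ → N ≠ ⊤ → IsUnravelledAt t N

/-- The set `Ω = {1, …, 2n}`. -/
abbrev Omega (n : ℕ) : Type := {k : ℕ // k ∈ Finset.Icc 1 (2 * n)}

/-- The transposition `(a, b)` in `Sym(Ω)`, for points `a, b` of `Ω = {1, …, 2n}`
(and the identity when `a` or `b` is not in `Ω`). -/
def transp (n a b : ℕ) : Equiv.Perm (Omega n) :=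
  if h : a ∈ Finset.Icc 1 (2 * n) ∧ b ∈ Finset.Icc 1 (2 * n) then
    Equiv.swap ⟨a, h.1⟩ ⟨b, h.2⟩
  else 1

/-- `∏_{i = 0}^{⌊(n-2)/2⌋} (1 + 2i, 2 + 2i)(n + 1 + 2i, n + 2 + 2i)`. -/
def perm1 (n : ℕ) : Equiv.Perm (Omega n) :=
  ((List.range ((n - 2) / 2 + 1)).map fun i =>
    transp n (1 + 2 * i) (2 + 2 * i) * transp n (n + 1 + 2 * i) (n + 2 + 2 * i)).prod

/-- `∏_{i = 1}^{⌊(n-3)/2⌋} (2 + 2i, 3 + 2i)(n + 2 + 2i, n + 3 + 2i)`. -/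
def perm2 (n : ℕ) : Equiv.Perm (Omega n) :=
  ((List.range' 1 ((n - 3) / 2)).map fun i =>
    transp n (2 + 2 * i) (3 + 2 * i) * transp n (n + 2 + 2 * i) (n + 3 + 2 * i)).prod

/-- `(1, 3)(2, 4)(n + 1, n + 3)(n + 2, n + 4)`. -/
def perm3 (n : ℕ) : Equiv.Perm (Omega n) :=
  transp n 1 3 * transp n 2 4 * transp n (n + 1) (n + 3) * transp n (n + 2) (n + 4)

/-- `(1, 2)(n + 1, n + 2) ∏_{i = 1}^{n-2} (2 + i, n + 2 + i)`. -/
def perm4 (n : ℕ) : Equiv.Perm (Omega n) :=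
  transp n 1 2 * transp n (n + 1) (n + 2) *
    ((List.range' 1 (n - 2)).map fun i => transp n (2 + i) (n + 2 + i)).prod

/-- The four explicit permutations of `Ω`, indexed by `0, 1, 2, 3`. -/
def permString (n : ℕ) : Fin 4 → Equiv.Perm (Omega n) :=
  ![perm1 n, perm2 n, perm3 n, perm4 n]

/-!
Labelling the points `i + 1` and `n + i + 1` by `(i, 1)` and `(i, -1)` turns the four permutations
into signed permutations of `n` points. The Coxeter group of type `B n` acts faithfully by signed
permutations: by induction on the rank, every element is a coset representative times an element of
the parabolic subgroup of smaller rank, and a representative is determined by the image of one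
signed point.

The product of the first two involutions has order `2n - 4`, because its cycles are a transposition
and an `(n - 2)`-cycle with `n - 2` odd. Its power of exponent `n - 2` is therefore a transposition,
and the first three involutions generate `Perm (Fin n)`. Conjugated by a sign vector, the last three
act on the first five points by permutations, up to a common sign which governs an involution
`(5 6)(7 8)⋯` of the remaining points, so they generate `ℤˣ × Perm (Fin 5)`. The intersection
property of the string follows from that of these two facets.

For the quotients, let `f` be a homomorphism which is not injective. If its kernel is not contained
in the sign vectors, it contains the alternating group and with it the third involution. Otherwise,
a sign vector in the kernel which is the sign part of an element `x` of the second facet identifies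
`f x` with the image of a permutation, that is, of an element of the first facet, so for a C-string
`x` has to agree with an element of the intersection of the facets. This excludes non-constant sign
vectors, which generate all those of product `1`, and also the constant `-1`: it is the sign part of
an element with permutation `(5 6)(7 8)⋯`, which is not trivial when `n > 5`.
-/

section IntersectionProperty

variable {G : Type*} [Group G] {r : ℕ} {t : Fin r → G}

theorem subgroupOn_mono (t : Fin r → G) {J K : Set (Fin r)} (h : J ⊆ K) :
    subgroupOn t J ≤ subgroupOn t K :=
  Subgroup.closure_mono (Set.image_mono h)

theorem mem_subgroupOn (t : Fin r → G) {J : Set (Fin r)} {i : Fin r} (hi : i ∈ J) :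
    t i ∈ subgroupOn t J :=
  Subgroup.subset_closure ⟨i, hi, rfl⟩

theorem subgroupOn_comp {H : Type*} [Group H] (f : G →* H) (t : Fin r → G) (J : Set (Fin r)) :
    subgroupOn (fun i => f (t i)) J = (subgroupOn t J).map f := by
  rw [subgroupOn, subgroupOn, MonoidHom.map_closure, Set.image_image]

theorem exists_mul_eq_of_mem_subgroupOn_union {J K : Set (Fin r)}
    (h : ∀ i ∈ J, ∀ k ∈ K, Commute (t i) (t k)) {g : G} (hg : g ∈ subgroupOn t (J ∪ K)) :
    ∃ x ∈ subgroupOn t J, ∃ y ∈ subgroupOn t K, x * y = g := by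
  have hle : subgroupOn t J ≤ Subgroup.normalizer (subgroupOn t K : Set G) := by
    refine le_trans ?_ (Subgroup.centralizer_le_normalizer _)
    rw [subgroupOn, subgroupOn, Subgroup.centralizer_closure, Subgroup.closure_le]
    rintro _ ⟨i, hi, rfl⟩
    rw [SetLike.mem_coe, Subgroup.mem_centralizer_iff]
    rintro _ ⟨k, hk, rfl⟩
    exact (h i hi k hk).symm
  rw [subgroupOn, Set.image_union, Subgroup.closure_union] at hg
  have hmul := Subgroup.coe_mul_of_left_le_normalizer_right _ _ hle
  exact Set.mem_mul.1 (hmul ▸ hg)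

theorem inf_subgroupOn_singleton_eq_bot {i j : Fin r} (hi : orderOf (t i) = 2)
    (hj : orderOf (t j) = 2) (hij : t i ≠ t j) :
    subgroupOn t {i} ⊓ subgroupOn t {j} = ⊥ := by
  have hmem : ∀ k, orderOf (t k) = 2 → ∀ g ∈ subgroupOn t {k}, g = 1 ∨ g = t k := by
    intro k hk g hg
    rw [subgroupOn, Set.image_singleton, ← Subgroup.zpowers_eq_closure] at hg
    obtain ⟨n, rfl⟩ := hg
    have hsq : t k ^ (2 : ℤ) = 1 := by exact_mod_cast hk ▸ pow_orderOf_eq_one (t k)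
    obtain ⟨m, rfl | rfl⟩ := Int.even_or_odd' n
    · exact Or.inl (by simp [zpow_mul, hsq])
    · exact Or.inr (by simp [zpow_add, zpow_mul, hsq])
  refine (Subgroup.eq_bot_iff_forall _).2 fun g hg => ?_
  rcases hmem i hi g hg.1 with h | rfl
  · exact h
  · exact (hmem j hj _ hg.2).resolve_right hij

/-- The intersection property for the subgroups generated by subsets of `I`. -/
def InterOn (t : Fin r → G) (I : Set (Fin r)) : Prop :=
  ∀ J ⊆ I, ∀ K ⊆ I, subgroupOn t J ⊓ subgroupOn t K ≤ subgroupOn t (J ∩ K)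

theorem InterOn.mono {I I' : Set (Fin r)} (h : InterOn t I') (hI : I ⊆ I') : InterOn t I :=
  fun J hJ K hK => h J (hJ.trans hI) K (hK.trans hI)

theorem interOn_of_subsingleton {I : Set (Fin r)} (hI : I.Subsingleton) : InterOn t I := by
  intro J hJ K hK
  rcases (hI.anti hJ).eq_empty_or_singleton with rfl | ⟨i, rfl⟩
  · exact inf_le_left.trans (subgroupOn_mono t (by simp))
  · rcases (hI.anti hK).eq_empty_or_singleton with rfl | ⟨k, rfl⟩
    · exact inf_le_right.trans (subgroupOn_mono t (by simp))
    · obtain rfl : i = k := hI (hJ rfl) (hK rfl)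
      exact inf_le_left.trans (subgroupOn_mono t (by simp))

section Interval

variable {a b m m' : Fin r}

theorem inf_subgroupOn_le_Ioo (hlo : InterOn t (Set.Ico a b)) (hhi : InterOn t (Set.Ioc a b))
    (hmid : subgroupOn t (Set.Ico a b) ⊓ subgroupOn t (Set.Ioc a b) ≤ subgroupOn t (Set.Ioo a b))
    (hm : a ≤ m) (hm' : m' ≤ b) :
    subgroupOn t (Set.Ico a m') ⊓ subgroupOn t (Set.Ioc m b) ≤ subgroupOn t (Set.Ioo m m') := by
  rintro u ⟨hu_lo, hu_hi⟩
  have hlo_sub : Set.Ico a m' ⊆ Set.Ico a b := Set.Ico_subset_Ico_right hm'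
  have hhi_sub : Set.Ioc m b ⊆ Set.Ioc a b := Set.Ioc_subset_Ioc_left hm
  have hab := hmid ⟨subgroupOn_mono t hlo_sub hu_lo, subgroupOn_mono t hhi_sub hu_hi⟩
  have ham := hlo _ hlo_sub _ Set.Ioo_subset_Ico_self ⟨hu_lo, hab⟩
  refine subgroupOn_mono t ?_ <| hhi _ hhi_sub (Set.Ico a m' ∩ Set.Ioo a b)
    (fun i hi => ⟨hi.2.1, hi.2.2.le⟩) ⟨hu_hi, ham⟩
  exact fun i hi => ⟨hi.1.1, hi.2.1.2⟩

variable (hcomm : ∀ i j : Fin r, 2 ≤ |((i : ℕ) : ℤ) - ((j : ℕ) : ℤ)| → Commute (t i) (t j))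

include hcomm

theorem exists_mul_eq_of_notMem {J : Set (Fin r)} (hm : m ∉ J) {g : G}
    (hg : g ∈ subgroupOn t J) :
    ∃ x ∈ subgroupOn t (J ∩ Set.Iio m), ∃ y ∈ subgroupOn t (J ∩ Set.Ioi m), x * y = g := by
  refine exists_mul_eq_of_mem_subgroupOn_union (fun i hi k hk => hcomm i k ?_)
    (subgroupOn_mono t (fun i hi => ?_) hg)
  · have := Fin.lt_def.1 hi.2
    have := Fin.lt_def.1 hk.2
    rw [abs_sub_comm]
    exact le_trans (by omega) (le_abs_self _)
  · rcases lt_trichotomy i m with h | rfl | h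
    · exact Or.inl ⟨hi, h⟩
    · exact absurd hi hm
    · exact Or.inr ⟨hi, h⟩

/-- Split `g = z y = x w` at the missing indices `m` of `J` and `m'` of `K`. The discrepancy
`u = x⁻¹ z = w y⁻¹` lies in the subgroup of the interval between `m` and `m'`. -/
theorem exists_mul_mul_eq_of_notMem (hlo : InterOn t (Set.Ico a b)) (hhi : InterOn t (Set.Ioc a b))
    (hmid : subgroupOn t (Set.Ico a b) ⊓ subgroupOn t (Set.Ioc a b) ≤ subgroupOn t (Set.Ioo a b))
    {J K : Set (Fin r)} (hJ : J ⊆ Set.Icc a b) (hK : K ⊆ Set.Icc a b)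
    (hm : m ∈ Set.Icc a b) (hm' : m' ∈ Set.Icc a b) (hmm : m ≤ m') (hmJ : m ∉ J) (hmK : m' ∉ K)
    {g : G} (hgJ : g ∈ subgroupOn t J) (hgK : g ∈ subgroupOn t K) :
    ∃ x ∈ subgroupOn t (K ∩ Set.Iio m'), ∃ u ∈ subgroupOn t (Set.Ioo m m'),
      ∃ y ∈ subgroupOn t (J ∩ Set.Ioi m), x * u * y = g ∧
        x * u ∈ subgroupOn t (J ∩ Set.Iio m) ∧ u * y ∈ subgroupOn t (K ∩ Set.Ioi m') := by
  obtain ⟨z, hz, y, hy, rfl⟩ := exists_mul_eq_of_notMem hcomm hmJ hgJ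
  obtain ⟨x, hx, w, hw, hxw⟩ := exists_mul_eq_of_notMem hcomm hmK hgK
  obtain ⟨u, rfl, rfl⟩ : ∃ u, z = x * u ∧ w = u * y :=
    ⟨x⁻¹ * z, by group, by rw [mul_assoc, ← hxw]; group⟩
  have hJm : J ∩ Set.Iio m ⊆ Set.Ico a m' := fun i hi => ⟨(hJ hi.1).1, hi.2.trans_le hmm⟩
  have hKm : K ∩ Set.Iio m' ⊆ Set.Ico a m' := fun i hi => ⟨(hK hi.1).1, hi.2⟩
  have hJm' : J ∩ Set.Ioi m ⊆ Set.Ioc m b := fun i hi => ⟨hi.2, (hJ hi.1).2⟩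
  have hKm' : K ∩ Set.Ioi m' ⊆ Set.Ioc m b := fun i hi => ⟨hmm.trans_lt hi.2, (hK hi.1).2⟩
  have hu : u ∈ subgroupOn t (Set.Ioo m m') := inf_subgroupOn_le_Ioo hlo hhi hmid hm.1 hm'.2
    ⟨(Subgroup.mul_mem_cancel_left _ (subgroupOn_mono t hKm hx)).1 (subgroupOn_mono t hJm hz),
      (Subgroup.mul_mem_cancel_right _ (subgroupOn_mono t hJm' hy)).1 (subgroupOn_mono t hKm' hw)⟩
  exact ⟨x, hx, u, hu, y, hy, rfl, hz, hw⟩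

theorem inf_subgroupOn_le_of_notMem (hlo : InterOn t (Set.Ico a b))
    (hhi : InterOn t (Set.Ioc a b))
    (hmid : subgroupOn t (Set.Ico a b) ⊓ subgroupOn t (Set.Ioc a b) ≤ subgroupOn t (Set.Ioo a b))
    {J K : Set (Fin r)} (hJ : J ⊆ Set.Icc a b) (hK : K ⊆ Set.Icc a b)
    (hm : m ∈ Set.Icc a b) (hm' : m' ∈ Set.Icc a b) (hmm : m ≤ m') (hmJ : m ∉ J) (hmK : m' ∉ K) :
    subgroupOn t J ⊓ subgroupOn t K ≤ subgroupOn t (J ∩ K) := by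
  rintro g ⟨hgJ, hgK⟩
  obtain ⟨x, hx, u, hu, y, hy, rfl, hz, hw⟩ :=
    exists_mul_mul_eq_of_notMem hcomm hlo hhi hmid hJ hK hm hm' hmm hmJ hmK hgJ hgK
  have hJlo : J ∩ Set.Iio m ⊆ Set.Ico a b := fun i hi => ⟨(hJ hi.1).1, hi.2.trans_le hm.2⟩
  have hJhi : J ∩ Set.Ioi m ⊆ Set.Ioc a b := fun i hi => ⟨hm.1.trans_lt hi.2, (hJ hi.1).2⟩
  have hKlo : K ∩ Set.Iio m' ⊆ Set.Ico a b := fun i hi => ⟨(hK hi.1).1, hi.2.trans_le hm'.2⟩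
  have hKhi : K ∩ Set.Ioi m' ⊆ Set.Ioc a b := fun i hi => ⟨hm'.1.trans_lt hi.2, (hK hi.1).2⟩
  have hIlo : Set.Ioo m m' ⊆ Set.Ico a b := fun i hi => ⟨hm.1.trans hi.1.le, hi.2.trans_le hm'.2⟩
  have hIhi : Set.Ioo m m' ⊆ Set.Ioc a b := fun i hi => ⟨hm.1.trans_lt hi.1, hi.2.le.trans hm'.2⟩
  have hxJK : x * u ∈ subgroupOn t (J ∩ K ∩ Set.Iio m') := by
    have hxK := mul_mem (subgroupOn_mono t Set.subset_union_left hx)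
      (subgroupOn_mono t (Set.subset_union_right (s := K ∩ Set.Iio m')) hu)
    refine subgroupOn_mono t ?_ (hlo _ hJlo _ (Set.union_subset hKlo hIlo) ⟨hz, hxK⟩)
    rintro i ⟨hi, hiK | him⟩
    exacts [⟨⟨hi.1, hiK.1⟩, hiK.2⟩, absurd him.1 hi.2.not_gt]
  have hyJK : u * y ∈ subgroupOn t (J ∩ K ∩ Set.Ioi m) := by
    have hyJ := mul_mem (subgroupOn_mono t (Set.subset_union_right (s := J ∩ Set.Ioi m)) hu)
      (subgroupOn_mono t Set.subset_union_left hy)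
    refine subgroupOn_mono t ?_ (hhi _ hKhi _ (Set.union_subset hJhi hIhi) ⟨hw, hyJ⟩)
    rintro i ⟨hi, hiJ | him⟩
    exacts [⟨⟨hiJ.1, hi.1⟩, hiJ.2⟩, absurd him.2 hi.2.not_gt]
  have huJ := (Subgroup.mul_mem_cancel_right _ hy).1
    (subgroupOn_mono t (Set.inter_subset_inter_left _ Set.inter_subset_left) hyJK)
  have huK := (Subgroup.mul_mem_cancel_left _ hx).1
    (subgroupOn_mono t (Set.inter_subset_inter_left _ Set.inter_subset_right) hxJK)
  have huJK := hlo _ (Set.inter_subset_right.trans hIlo) _ hKlo ⟨hhi _ hJhi _ hIhi ⟨huJ, hu⟩, huK⟩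
  have hu' : u ∈ subgroupOn t (J ∩ K) := by
    refine subgroupOn_mono t ?_ huJK
    exact fun i hi => ⟨hi.1.1.1, hi.2.1⟩
  exact mul_mem (subgroupOn_mono t Set.inter_subset_left hxJK) <|
    (Subgroup.mul_mem_cancel_left _ hu').1 (subgroupOn_mono t Set.inter_subset_left hyJK)

theorem interOn_Icc (hlo : InterOn t (Set.Ico a b)) (hhi : InterOn t (Set.Ioc a b))
    (hmid : subgroupOn t (Set.Ico a b) ⊓ subgroupOn t (Set.Ioc a b) ≤
      subgroupOn t (Set.Ioo a b)) :
    InterOn t (Set.Icc a b) := by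
  intro J hJ K hK
  rcases hJ.eq_or_ssubset with rfl | hJ'
  · rw [Set.inter_eq_right.2 hK]
    exact inf_le_right
  rcases hK.eq_or_ssubset with rfl | hK'
  · rw [Set.inter_eq_left.2 hJ]
    exact inf_le_left
  obtain ⟨m, hm, hmJ⟩ := Set.exists_of_ssubset hJ'
  obtain ⟨m', hm', hmK⟩ := Set.exists_of_ssubset hK'
  rcases le_total m m' with h | h
  · exact inf_subgroupOn_le_of_notMem hcomm hlo hhi hmid hJ hK hm hm' h hmJ hmK
  · rw [inf_comm, Set.inter_comm]
    exact inf_subgroupOn_le_of_notMem hcomm hlo hhi hmid hK hJ hm' hm h hmK hmJ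

theorem interOn_univ_of_intervals
    (h : ∀ a b : Fin r, a < b →
      subgroupOn t (Set.Ico a b) ⊓ subgroupOn t (Set.Ioc a b) ≤ subgroupOn t (Set.Ioo a b)) :
    InterOn t Set.univ := by
  have hIcc : ∀ k : ℕ, ∀ a b : Fin r, (b : ℕ) < a + k → InterOn t (Set.Icc a b) := by
    intro k
    induction k with
    | zero => exact fun a b hab => interOn_of_subsingleton (by
        rw [Set.Icc_eq_empty (by simpa using hab)]
        exact Set.subsingleton_empty)
    | succ k ih =>
      intro a b hk
      rcases lt_trichotomy a b with hab | rfl | hab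
      · have := Fin.lt_def.1 hab
        refine interOn_Icc hcomm
          ((ih a ⟨b - 1, by omega⟩ (by simp only; omega)).mono fun i hi => ⟨hi.1, ?_⟩)
          ((ih ⟨a + 1, by omega⟩ b (by simp only; omega)).mono fun i hi => ⟨?_, hi.2⟩) (h a b hab)
        · have := Fin.lt_def.1 hi.2
          exact Fin.le_def.2 (by simp only; omega)
        · exact Fin.le_def.2 (Fin.lt_def.1 hi.1)
      · exact interOn_of_subsingleton (by simp)
      · rw [Set.Icc_eq_empty hab.not_ge]
        exact interOn_of_subsingleton Set.subsingleton_empty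
  cases r with
  | zero => exact interOn_of_subsingleton Set.subsingleton_of_subsingleton
  | succ r =>
    exact (hIcc (r + 1) 0 (Fin.last r) (by simp)).mono fun i _ => ⟨Fin.zero_le i, Fin.le_last i⟩

end Interval

theorem isCString_of_intervals (hinv : ∀ i, orderOf (t i) = 2)
    (hgen : Subgroup.closure (Set.range t) = ⊤)
    (hcomm : ∀ i j : Fin r, 2 ≤ |((i : ℕ) : ℤ) - ((j : ℕ) : ℤ)| → Commute (t i) (t j))
    (hinj : Function.Injective t)
    (hinter : ∀ a b : Fin r, (a : ℕ) + 1 < b →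
      subgroupOn t (Set.Ico a b) ⊓ subgroupOn t (Set.Ioc a b) ≤ subgroupOn t (Set.Ioo a b)) :
    IsCString t where
  involution := hinv
  generates := hgen
  commute := hcomm
  inter J K := by
    have hlt : ∀ a b : Fin r, a < b →
        subgroupOn t (Set.Ico a b) ⊓ subgroupOn t (Set.Ioc a b) ≤ subgroupOn t (Set.Ioo a b) := by
      intro a b hab
      rcases (Nat.succ_le_of_lt (Fin.lt_def.1 hab)).eq_or_lt with hb | hb
      · have hIco : Set.Ico a b = {a} := Set.ext fun i => by
          simp only [Set.mem_Ico, Set.mem_singleton_iff, Fin.ext_iff, Fin.le_def, Fin.lt_def]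
          omega
        have hIoc : Set.Ioc a b = {b} := Set.ext fun i => by
          simp only [Set.mem_Ioc, Set.mem_singleton_iff, Fin.ext_iff, Fin.le_def, Fin.lt_def]
          omega
        rw [hIco, hIoc, inf_subgroupOn_singleton_eq_bot (hinv a) (hinv b) (hinj.ne hab.ne)]
        exact bot_le
      · exact hinter a b hb
    exact (interOn_univ_of_intervals hcomm hlt J J.subset_univ K K.subset_univ).antisymm <|
      le_inf (subgroupOn_mono t Set.inter_subset_left) (subgroupOn_mono t Set.inter_subset_right)

theorem IsCString.map {H : Type*} [Group H] (h : IsCString t) (e : G ≃* H) :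
    IsCString fun i => e (t i) where
  involution i := by rw [MulEquiv.orderOf_eq, h.involution]
  generates := by
    rw [Set.range_comp' e t, ← MulEquiv.coe_toMonoidHom, ← MonoidHom.map_closure, h.generates,
      Subgroup.map_top_of_surjective _ e.surjective]
  commute i j hij := (h.commute i j hij).map e
  inter J K := by
    have hcomp : ∀ J, subgroupOn (fun i => e (t i)) J = (subgroupOn t J).map e.toMonoidHom :=
      subgroupOn_comp e.toMonoidHom t
    rw [hcomp, hcomp, hcomp, ← h.inter, Subgroup.map_inf _ _ _ e.injective]

/-- An isomorphism `G ≃* H` restricts to the subgroups `G_J` and `H_J` of a string and its image. -/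
noncomputable def subgroupOnEquiv {H : Type*} [Group H] (e : G ≃* H) (t : Fin r → G)
    (J : Set (Fin r)) : subgroupOn t J ≃* subgroupOn (fun i => e (t i)) J :=
  (e.subgroupMap _).trans (MulEquiv.subgroupCongr (subgroupOn_comp e.toMonoidHom t J).symm)

theorem HasSchlafliSymbol.map {H : Type*} [Group H] {t : Fin (r + 1) → G} {p : Fin r → ℕ}
    (h : HasSchlafliSymbol t p) (e : G ≃* H) : HasSchlafliSymbol (fun i => e (t i)) p := by
  intro i
  rw [← h i, ← map_mul, MulEquiv.orderOf_eq]

theorem isUnravelledAt_of_not_isCString {N : Subgroup G} [N.Normal]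
    (h : ¬ IsCString fun i => (t i : G ⧸ N)) : IsUnravelledAt t N := by
  have hle : (Set.range fun i => (t i : G ⧸ N)).ncard ≤ r := by
    rw [← Set.image_univ]
    exact (Set.ncard_image_le Set.finite_univ).trans (by simp)
  exact hle.lt_or_eq.imp_right fun heq => ⟨heq, h⟩

end IntersectionProperty

section TypeBFamily

/-- Elements `u 0, …, u (n - 1)` of a group satisfying the Coxeter relations of type `B n`,
numbered from the end of the Coxeter diagram which carries the bond of order four. -/
structure IsTypeBFamily {W : Type*} [Group W] (n : ℕ) (u : ℕ → W) : Prop where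
  mul_self : ∀ i < n, u i * u i = 1
  commute : ∀ i j, i + 1 < j → j < n → Commute (u i) (u j)
  braid : ∀ i, 0 < i → i + 1 < n → u i * u (i + 1) * u i = u (i + 1) * u i * u (i + 1)
  braid_four : 1 < n → u 0 * u 1 * u 0 * u 1 = u 1 * u 0 * u 1 * u 0

/-- The subgroup generated by the first `k` members of a family. -/
def initialSubgroup {W : Type*} [Group W] (u : ℕ → W) (k : ℕ) : Subgroup W :=
  Subgroup.closure (u '' Set.Iio k)

/-- The reflection `u k ⋯ u 1 * u 0 * u 1 ⋯ u k`, which acts as the sign change of the `k`-th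
coordinate. -/
def signReflection {W : Type*} [Group W] (u : ℕ → W) : ℕ → W
  | 0 => u 0
  | k + 1 => u (k + 1) * signReflection u k * u (k + 1)

/-- Representatives of the left cosets of `initialSubgroup u k` in `initialSubgroup u (k + 1)`,
for a family `u` of type `B`. -/
def cosetReps {W : Type*} [Group W] (u : ℕ → W) : ℕ → Set W
  | 0 => {1, u 0}
  | k + 1 => {1, signReflection u (k + 1)} ∪ (· * u (k + 1)) '' cosetReps u k

theorem exists_mul_eq_of_mem_closure {G : Type*} [Group G] {S R : Set G} {H : Subgroup G}
    (hS : ∀ s ∈ S, s * s = 1) (hR : 1 ∈ R)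
    (hSR : ∀ s ∈ S, ∀ r ∈ R, ∃ r' ∈ R, ∃ h ∈ H, r' * h = s * r)
    {g : G} (hg : g ∈ Subgroup.closure S) : ∃ r ∈ R, ∃ h ∈ H, r * h = g := by
  have hmul : ∀ s ∈ S, ∀ g, (∃ r ∈ R, ∃ h ∈ H, r * h = g) → ∃ r ∈ R, ∃ h ∈ H, r * h = s * g := by
    rintro s hs _ ⟨r, hr, h, hh, rfl⟩
    obtain ⟨r', hr', h', hh', e⟩ := hSR s hs r hr
    exact ⟨r', hr', h' * h, mul_mem hh' hh, by rw [← mul_assoc, e, mul_assoc]⟩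
  induction hg using Subgroup.closure_induction_left with
  | one => exact ⟨1, hR, 1, one_mem H, one_mul 1⟩
  | mul_left s hs g _ ih => exact hmul s hs g ih
  | inv_mul_cancel s hs g _ ih =>
    rw [inv_eq_of_mul_eq_one_left (hS s hs)]
    exact hmul s hs g ih

section InitialSubgroup

variable {W : Type*} [Group W] {u : ℕ → W}

theorem mem_initialSubgroup (u : ℕ → W) {i k : ℕ} (h : i < k) : u i ∈ initialSubgroup u k :=
  Subgroup.subset_closure ⟨i, h, rfl⟩

theorem initialSubgroup_mono (u : ℕ → W) : Monotone (initialSubgroup u) :=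
  fun _ _ h => Subgroup.closure_mono (Set.image_mono (Set.Iio_subset_Iio h))

theorem signReflection_mem (u : ℕ → W) (k : ℕ) :
    signReflection u k ∈ initialSubgroup u (k + 1) := by
  induction k with
  | zero => exact mem_initialSubgroup u zero_lt_one
  | succ k ih =>
    have hu := mem_initialSubgroup u (Nat.lt_succ_self (k + 1))
    exact mul_mem (mul_mem hu (initialSubgroup_mono u (Nat.le_succ _) ih)) hu

theorem signReflection_mem_cosetReps (u : ℕ → W) (k : ℕ) : signReflection u k ∈ cosetReps u k := by
  cases k <;> simp [cosetReps, signReflection]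

theorem one_mem_cosetReps (u : ℕ → W) (k : ℕ) : 1 ∈ cosetReps u k := by
  cases k <;> simp [cosetReps]

theorem cosetReps_subset (u : ℕ → W) (k : ℕ) : cosetReps u k ⊆ initialSubgroup u (k + 1) := by
  induction k with
  | zero =>
    rintro _ (rfl | rfl)
    exacts [one_mem _, mem_initialSubgroup u zero_lt_one]
  | succ k ih =>
    rintro _ ((rfl | rfl) | ⟨r, hr, rfl⟩)
    · exact one_mem _
    · exact signReflection_mem u (k + 1)
    · exact mul_mem (initialSubgroup_mono u (Nat.le_succ _) (ih hr))
        (mem_initialSubgroup u (Nat.lt_succ_self _))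

end InitialSubgroup

namespace IsTypeBFamily

variable {W : Type*} [Group W] {n : ℕ} {u : ℕ → W} (hu : IsTypeBFamily n u)

include hu

theorem commute_of_mem {k : ℕ} (hk : k + 1 < n) {g : W} (hg : g ∈ initialSubgroup u k) :
    Commute (u (k + 1)) g := by
  induction hg using Subgroup.closure_induction with
  | mem _ hx =>
    obtain ⟨i, hi, rfl⟩ := hx
    exact (hu.commute i (k + 1) (Nat.succ_lt_succ hi) hk).symm
  | one => exact Commute.one_right _
  | mul _ _ _ _ hx hy => exact hx.mul_right hy
  | inv _ _ hx => exact hx.inv_right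

theorem commute_signReflection {i k : ℕ} (hik : i < k) (hk : k < n) :
    Commute (u i) (signReflection u k) := by
  induction k with
  | zero => omega
  | succ k ih =>
    rcases (Nat.lt_succ_iff.1 hik).lt_or_eq with hik | rfl
    · have hcomm := hu.commute i (k + 1) (by omega) hk
      exact (hcomm.mul_right (ih hik (by omega))).mul_right hcomm
    · cases i with
      | zero => simpa only [Commute, SemiconjBy, signReflection, mul_assoc] using hu.braid_four hk
      | succ j =>
        have hcomm := hu.commute_of_mem hk (signReflection_mem u j)
        have hbraid := hu.braid (j + 1) (by omega) hk
        calc u (j + 1) * (u (j + 2) * (u (j + 1) * signReflection u j * u (j + 1)) * u (j + 2))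
            = u (j + 1) * u (j + 2) * u (j + 1) * signReflection u j * (u (j + 1) * u (j + 2)) := by
              simp only [mul_assoc]
          _ = u (j + 2) * u (j + 1) * (signReflection u j * u (j + 2)) *
                (u (j + 1) * u (j + 2)) := by
              rw [hbraid, ← hcomm.eq]; simp only [mul_assoc]
          _ = u (j + 2) * u (j + 1) * signReflection u j * (u (j + 1) * u (j + 2) * u (j + 1)) := by
              rw [hbraid]; simp only [mul_assoc]
          _ = _ := by simp only [signReflection, mul_assoc]

theorem last_mul_mul_last_mem_cosetReps {k : ℕ} (hk : k + 1 < n) {r : W}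
    (hr : r ∈ cosetReps u k) :
    ∃ r' ∈ cosetReps u (k + 1), ∃ h ∈ initialSubgroup u (k + 1),
      r' * h = u (k + 1) * (r * u (k + 1)) := by
  have hone : u (k + 1) * (1 * u (k + 1)) = 1 := by rw [one_mul, hu.mul_self (k + 1) hk]
  have hsign : u (k + 1) * (signReflection u k * u (k + 1)) = signReflection u (k + 1) :=
    (mul_assoc _ _ _).symm
  cases k with
  | zero =>
    rcases hr with rfl | rfl
    · exact ⟨1, one_mem_cosetReps u _, 1, one_mem _, by rw [hone, one_mul]⟩
    · exact ⟨_, signReflection_mem_cosetReps u _, 1, one_mem _, by rw [← hsign, mul_one]; rfl⟩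
  | succ k =>
    rcases hr with (rfl | rfl) | ⟨r, hr, rfl⟩
    · exact ⟨1, one_mem_cosetReps u _, 1, one_mem _, by rw [hone, one_mul]⟩
    · exact ⟨_, signReflection_mem_cosetReps u _, 1, one_mem _, by rw [← hsign, mul_one]⟩
    · refine ⟨r * u (k + 1) * u (k + 2), Or.inr ⟨_, Or.inr ⟨r, hr, rfl⟩, rfl⟩, u (k + 1),
        mem_initialSubgroup u (Nat.lt_succ_self _), ?_⟩
      have hcomm := hu.commute_of_mem hk (cosetReps_subset u k hr)
      calc r * u (k + 1) * u (k + 2) * u (k + 1)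
          = r * (u (k + 2) * u (k + 1) * u (k + 2)) := by
            rw [← hu.braid (k + 1) (by omega) hk]; simp only [mul_assoc]
        _ = r * u (k + 2) * (u (k + 1) * u (k + 2)) := by simp only [mul_assoc]
        _ = u (k + 2) * (r * u (k + 1) * u (k + 2)) := by rw [← hcomm.eq]; simp only [mul_assoc]

theorem last_mul_mem_cosetReps {k : ℕ} (hk : k < n) {r : W} (hr : r ∈ cosetReps u k) :
    ∃ r' ∈ cosetReps u k, ∃ h ∈ initialSubgroup u k, r' * h = u k * r := by
  have hsq := hu.mul_self k hk
  cases k with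
  | zero =>
    rcases hr with rfl | rfl
    · exact ⟨u 0, signReflection_mem_cosetReps u 0, 1, one_mem _, rfl⟩
    · exact ⟨1, one_mem_cosetReps u 0, 1, one_mem _, by rw [hsq, one_mul]⟩
  | succ k =>
    rcases hr with (rfl | rfl) | ⟨r, hr, rfl⟩
    · exact ⟨1 * u (k + 1), Or.inr ⟨1, one_mem_cosetReps u k, rfl⟩, 1, one_mem _, by simp⟩
    · refine ⟨signReflection u k * u (k + 1), Or.inr ⟨_, signReflection_mem_cosetReps u k, rfl⟩,
        1, one_mem _, ?_⟩
      simp only [signReflection, ← mul_assoc, hsq, one_mul, mul_one]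
    · exact hu.last_mul_mul_last_mem_cosetReps hk hr

theorem generator_mul_mem_cosetReps {i k : ℕ} (hik : i ≤ k) (hk : k < n) {r : W}
    (hr : r ∈ cosetReps u k) :
    ∃ r' ∈ cosetReps u k, ∃ h ∈ initialSubgroup u k, r' * h = u i * r := by
  induction k generalizing r with
  | zero =>
    obtain rfl := Nat.le_zero.1 hik
    exact hu.last_mul_mem_cosetReps hk hr
  | succ k ih =>
    rcases hik.lt_or_eq with hik | rfl
    · have hi := mem_initialSubgroup u hik
      rcases hr with (rfl | rfl) | ⟨r, hr, rfl⟩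
      · exact ⟨1, one_mem_cosetReps u _, u i, hi, by simp⟩
      · exact ⟨_, signReflection_mem_cosetReps u _, u i, hi,
          (hu.commute_signReflection hik hk).eq.symm⟩
      · obtain ⟨r', hr', h, hh, e⟩ := ih (Nat.lt_succ_iff.1 hik) (by omega) hr
        refine ⟨r' * u (k + 1), Or.inr ⟨r', hr', rfl⟩, h,
          initialSubgroup_mono u (Nat.le_succ k) hh, ?_⟩
        rw [mul_assoc, hu.commute_of_mem hk hh, ← mul_assoc, e, mul_assoc]
    · exact hu.last_mul_mem_cosetReps hk hr

theorem exists_cosetRep_mul_eq {k : ℕ} (hk : k < n) {w : W}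
    (hw : w ∈ initialSubgroup u (k + 1)) :
    ∃ r ∈ cosetReps u k, ∃ h ∈ initialSubgroup u k, r * h = w := by
  refine exists_mul_eq_of_mem_closure ?_ (one_mem_cosetReps u k) ?_ hw
  · rintro _ ⟨i, hi, rfl⟩
    exact hu.mul_self i (lt_of_lt_of_le hi hk)
  · rintro _ ⟨i, hi, rfl⟩ r hr
    exact hu.generator_mul_mem_cosetReps (Nat.lt_succ_iff.1 hi) hk hr

end IsTypeBFamily

section Faithful

variable {W : Type*} [Group W] {n : ℕ} {u : ℕ → W} {X : Type*} {f : W →* Equiv.Perm X}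
  {x y : ℕ → X}

theorem map_apply_eq_of_mem_initialSubgroup {k : ℕ} (hfix : ∀ i < k, f (u i) (x k) = x k)
    {h : W} (hh : h ∈ initialSubgroup u k) : f h (x k) = x k := by
  suffices initialSubgroup u k ≤ (MulAction.stabilizer (Equiv.Perm X) (x k)).comap f from this hh
  rw [initialSubgroup, Subgroup.closure_le]
  rintro _ ⟨i, hi, rfl⟩
  exact hfix i hi

variable (hzero : f (u 0) (x 0) = y 0) (hx : ∀ k, k + 1 < n → f (u (k + 1)) (x (k + 1)) = x k)
  (hy : ∀ k, k + 1 < n → f (u (k + 1)) (y k) = y (k + 1))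

include hzero hx hy

theorem map_signReflection_apply {k : ℕ} (hk : k < n) : f (signReflection u k) (x k) = y k := by
  induction k with
  | zero => exact hzero
  | succ k ih =>
    rw [signReflection, map_mul, map_mul, Equiv.Perm.mul_apply, Equiv.Perm.mul_apply, hx k hk,
      ih (by omega), hy k hk]

variable (hfix : ∀ i k, i < k → k < n → f (u i) (x k) = x k)
  (hxx : ∀ k, k + 1 < n → x k ≠ x (k + 1)) (hxy : ∀ k < n, x k ≠ y k)

include hfix hxx hxy

theorem eq_one_of_mem_cosetReps {k : ℕ} (hk : k < n) {r : W} (hr : r ∈ cosetReps u k)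
    (hrk : f r (x k) = x k) : r = 1 := by
  cases k with
  | zero =>
    rcases hr with rfl | rfl
    exacts [rfl, absurd (hrk.symm.trans hzero) (hxy 0 hk)]
  | succ k =>
    rcases hr with (rfl | rfl) | ⟨r, hr, rfl⟩
    · rfl
    · exact absurd (hrk.symm.trans (map_signReflection_apply hzero hx hy hk)) (hxy _ hk)
    · have hrk' : f r (x (k + 1)) = x (k + 1) := map_apply_eq_of_mem_initialSubgroup
        (fun i hi => hfix i _ hi hk) (cosetReps_subset u k hr)
      rw [map_mul, Equiv.Perm.mul_apply, hx k hk] at hrk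
      exact absurd ((f r).injective (hrk.trans hrk'.symm)) (hxx k hk)

/-- In the group of signed permutations `x k` and `y k` are the two signed versions of the
`k`-th point. -/
theorem IsTypeBFamily.eq_one_of_map_eq_one (hu : IsTypeBFamily n u) {k : ℕ} (hk : k ≤ n) {w : W}
    (hw : w ∈ initialSubgroup u k) (hfw : f w = 1) : w = 1 := by
  induction k generalizing w with
  | zero => simpa [initialSubgroup] using hw
  | succ k ih =>
    obtain ⟨r, hr, h, hh, rfl⟩ := hu.exists_cosetRep_mul_eq hk hw
    have hhk : f h (x k) = x k :=
      map_apply_eq_of_mem_initialSubgroup (fun i hi => hfix i k hi hk) hh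
    have hrk : f r (x k) = x k := by
      rw [map_mul] at hfw
      simpa [hhk] using congrArg (fun g => g (x k)) hfw
    obtain rfl := eq_one_of_mem_cosetReps hzero hx hy hfix hxx hxy hk hr hrk
    rw [one_mul] at hfw ⊢
    exact ih (by omega) hh hfw

end Faithful

end TypeBFamily

/-- The group of signed permutations of `α`. -/
abbrev SignedPerm (α : Type*) : Type _ :=
  (α → ℤˣ) ⋊[mulAutArrow (G := Equiv.Perm α) (A := α) (M := ℤˣ)] Equiv.Perm α

namespace SignedPerm

open SemidirectProduct Equiv

variable {α : Type*}

theorem mul_left_apply (x y : SignedPerm α) (i : α) :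
    (x * y).left i = x.left i * y.left (x.right⁻¹ i) := rfl

theorem conj_inl (g : Perm α) (a : α → ℤˣ) :
    (inr g * inl a * (inr g)⁻¹ : SignedPerm α) = inl fun i => a (g⁻¹ i) := by
  rw [← map_inv, ← inl_aut]
  rfl

/-- The action of a signed permutation on the signed points. -/
def toPerm : SignedPerm α →* Perm (α × ℤˣ) where
  toFun x :=
    { toFun := fun p => (x.right p.1, x.left (x.right p.1) * p.2)
      invFun := fun p => (x.right⁻¹ p.1, x.left p.1 * p.2)
      left_inv := fun p => by
        ext1
        · simp
        · simp only [← mul_assoc, Int.units_mul_self, one_mul]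
      right_inv := fun p => by
        ext1
        · simp
        · simp [← mul_assoc, Int.units_mul_self] }
  map_one' := by ext p <;> simp
  map_mul' x y := by
    ext1 p
    simp [mul_left_apply, mul_assoc]

theorem toPerm_apply (x : SignedPerm α) (p : α × ℤˣ) :
    toPerm x p = (x.right p.1, x.left (x.right p.1) * p.2) := rfl

theorem toPerm_injective : Function.Injective (toPerm (α := α)) := by
  refine (injective_iff_map_eq_one _).2 fun x hx => ?_
  have h : ∀ i, x.right i = i ∧ x.left (x.right i) = 1 := fun i => by
    simpa [toPerm_apply] using congrArg (fun g => g (i, 1)) hx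
  have hright : x.right = 1 := Perm.ext fun i => (h i).1
  ext i
  · simpa [hright] using (h i).2
  · simp [hright]

variable [DecidableEq α]

theorem conj_inl_mulSingle (g : Perm α) (i : α) (e : ℤˣ) :
    (inr g * inl (Pi.mulSingle i e) * (inr g)⁻¹ : SignedPerm α) =
      inl (Pi.mulSingle (g i) e) := by
  rw [conj_inl]
  congr 1
  funext j
  simp only [Pi.mulSingle_apply, Perm.inv_eq_iff_eq]

theorem inl_mem_of_mulSingle_mem [Finite α] {K : Subgroup (SignedPerm α)}
    (h : ∀ i, (inl (Pi.mulSingle i (-1)) : SignedPerm α) ∈ K) (a : α → ℤˣ) :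
    (inl a : SignedPerm α) ∈ K := by
  have := Fintype.ofFinite α
  rw [← Finset.univ_prod_mulSingle a, ← Subgroup.mem_comap]
  refine Subgroup.prod_mem _ fun i _ => ?_
  rw [Subgroup.mem_comap]
  rcases Int.units_eq_one_or (a i) with hi | hi
  · simp [hi]
  · exact hi ▸ h i

theorem eq_top_of_inr_mem [Finite α] {K : Subgroup (SignedPerm α)} (hK : ∀ g, inr g ∈ K) {i : α}
    (hi : inl (Pi.mulSingle i (-1)) ∈ K) : K = ⊤ := by
  refine eq_top_iff.2 fun x _ => ?_
  rw [← inl_left_mul_inr_right x]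
  refine mul_mem (inl_mem_of_mulSingle_mem (fun j => ?_) _) (hK _)
  have := mul_mem (mul_mem (hK (swap i j)) hi) (inv_mem (hK (swap i j)))
  rwa [conj_inl_mulSingle, swap_apply_left] at this

/-- The simple reflections of the group of signed permutations: the transpositions of
neighbouring points, and the sign change of the last point. -/
def simpleReflection (n : ℕ) (i : Fin n) : SignedPerm (Fin n) :=
  if h : (i : ℕ) + 1 < n then inr (swap i ⟨i + 1, h⟩) else inl (Pi.mulSingle i (-1))

theorem simpleReflection_of_add_one_eq {n : ℕ} {i j : Fin n} (h : (i : ℕ) + 1 = j) :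
    simpleReflection n i = inr (swap i j) := by
  rw [simpleReflection, dif_pos (h ▸ j.2)]
  congr 2
  exact Fin.ext h

theorem simpleReflection_of_add_one_eq_card {n : ℕ} {i : Fin n} (h : (i : ℕ) + 1 = n) :
    simpleReflection n i = inl (Pi.mulSingle i (-1)) :=
  dif_neg h.not_lt

theorem closure_range_simpleReflection (n : ℕ) [NeZero n] :
    Subgroup.closure (Set.range (simpleReflection n)) = ⊤ := by
  obtain ⟨m, rfl⟩ := Nat.exists_eq_succ_of_ne_zero (NeZero.ne n)
  have hmem : ∀ i, simpleReflection (m + 1) i ∈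
      Subgroup.closure (Set.range (simpleReflection (m + 1))) :=
    fun i => Subgroup.subset_closure ⟨i, rfl⟩
  refine eq_top_of_inr_mem (fun g => ?_) (i := Fin.last m) ?_
  · have hg : g ∈ Submonoid.closure (Set.range fun i : Fin m => swap i.castSucc i.succ) := by
      rw [Perm.mclosure_swap_castSucc_succ]
      exact Submonoid.mem_top g
    induction hg using Submonoid.closure_induction with
    | mem _ hx =>
      obtain ⟨i, rfl⟩ := hx
      have hi : ((i.castSucc : Fin (m + 1)) : ℕ) + 1 = (i.succ : Fin (m + 1)) := rfl
      exact simpleReflection_of_add_one_eq hi ▸ hmem _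
    | one => exact map_one (inr : Perm _ →* SignedPerm _) ▸ one_mem _
    | mul x y _ _ hx hy => exact map_mul (inr : Perm _ →* SignedPerm _) x y ▸ mul_mem hx hy
  · have hlast : ((Fin.last m : Fin (m + 1)) : ℕ) + 1 = m + 1 := rfl
    exact simpleReflection_of_add_one_eq_card hlast ▸ hmem (Fin.last m)

theorem simpleReflection_mul_self {n : ℕ} (i : Fin n) :
    simpleReflection n i * simpleReflection n i = 1 := by
  unfold simpleReflection
  split_ifs with h
  · rw [← map_mul, swap_mul_self, map_one]
  · rw [← map_mul, ← Pi.mulSingle_mul]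
    simp

theorem commute_simpleReflection {n : ℕ} {i j : Fin n} (hij : (i : ℕ) + 1 < j) :
    Commute (simpleReflection n i) (simpleReflection n j) := by
  obtain ⟨i', hi'⟩ : ∃ i' : Fin n, (i : ℕ) + 1 = i' := ⟨⟨i + 1, hij.trans j.2⟩, rfl⟩
  have hji : j ≠ i := by rintro rfl; omega
  have hji' : j ≠ i' := by rintro rfl; omega
  rw [simpleReflection_of_add_one_eq hi', simpleReflection]
  split_ifs with hj
  · refine Commute.map (Commute.symm ?_) inr
    rw [commute_iff_eq, mul_swap_eq_swap_mul, swap_apply_of_ne_of_ne hji.symm,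
      swap_apply_of_ne_of_ne hji'.symm] <;>
    simp only [ne_eq, Fin.ext_iff] <;> omega
  · have hconj := conj_inl_mulSingle (swap i i') j (-1)
    rwa [swap_apply_of_ne_of_ne hji hji', mul_inv_eq_iff_eq_mul] at hconj

theorem simpleReflection_mul_pow_three {n : ℕ} {i j k : Fin n} (hij : (i : ℕ) + 1 = j)
    (hjk : (j : ℕ) + 1 = k) : (simpleReflection n i * simpleReflection n j) ^ 3 = 1 := by
  have hcycle : (swap j i * swap j k).IsThreeCycle := by
    apply Perm.isThreeCycle_swap_mul_swap_same <;> simp only [ne_eq, Fin.ext_iff] <;> omega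
  rw [simpleReflection_of_add_one_eq hij, simpleReflection_of_add_one_eq hjk, swap_comm i j,
    ← map_mul, ← map_pow, ← hcycle.orderOf, pow_orderOf_eq_one, map_one]

theorem simpleReflection_mul_pow_four {n : ℕ} {i j : Fin n} (hij : (i : ℕ) + 1 = j)
    (hj : (j : ℕ) + 1 = n) : (simpleReflection n i * simpleReflection n j) ^ 4 = 1 := by
  rw [simpleReflection_of_add_one_eq hij, simpleReflection_of_add_one_eq_card hj]
  have hsq : (inr (swap i j) * inl (Pi.mulSingle j (-1)) : SignedPerm (Fin n)) ^ 2 =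
      inl (Pi.mulSingle i (-1) * Pi.mulSingle j (-1)) := by
    have hconj := conj_inl_mulSingle (swap i j) j (-1)
    rw [← map_inv, swap_inv, swap_apply_right] at hconj
    rw [pow_two, ← mul_assoc, hconj, map_mul]
  rw [show 4 = 2 * 2 from rfl, pow_mul, hsq, pow_two, ← map_mul]
  simp [mul_mul_mul_comm, ← Pi.mulSingle_mul]

end SignedPerm

section CoxeterB

open SemidirectProduct Equiv

theorem coxeterMatrixB_apply_of_lt {n : ℕ} {i j : Fin n} (hij : i < j) :
    CoxeterMatrix.B n i j =
      if (i : ℕ) + 1 = j then (if (j : ℕ) + 1 = n then 4 else 3) else 2 := by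
  have := j.2
  change (if i = j then 1 else _) = _
  rw [if_neg hij.ne]
  split_ifs <;> omega

theorem isLiftable_simpleReflection (n : ℕ) :
    (CoxeterMatrix.B n).IsLiftable (SignedPerm.simpleReflection n) := by
  have hlt : ∀ i j : Fin n, i < j → (SignedPerm.simpleReflection n i *
      SignedPerm.simpleReflection n j) ^ CoxeterMatrix.B n i j = 1 := by
    intro i j hij
    have := Fin.lt_def.1 hij
    rw [coxeterMatrixB_apply_of_lt hij]
    split_ifs with hnext hlast
    · exact SignedPerm.simpleReflection_mul_pow_four hnext hlast
    · exact SignedPerm.simpleReflection_mul_pow_three (k := ⟨j + 1, by omega⟩) hnext rfl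
    · rw [(SignedPerm.commute_simpleReflection (by omega)).mul_pow, pow_two, pow_two,
        SignedPerm.simpleReflection_mul_self, SignedPerm.simpleReflection_mul_self, one_mul]
  intro i j
  rcases lt_trichotomy i j with hij | rfl | hij
  · exact hlt i j hij
  · rw [SignedPerm.simpleReflection_mul_self, one_pow]
  · rw [← inv_eq_one, ← inv_pow, mul_inv_rev, CoxeterMatrix.symmetric,
      inv_eq_of_mul_eq_one_left (SignedPerm.simpleReflection_mul_self i),
      inv_eq_of_mul_eq_one_left (SignedPerm.simpleReflection_mul_self j), hlt j i hij]

/-- The homomorphism from the Coxeter group of type `B n` to the signed permutations which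
extends `SignedPerm.simpleReflection`. -/
def coxeterToSignedPerm (n : ℕ) : (CoxeterMatrix.B n).Group →* SignedPerm (Fin n) :=
  (CoxeterMatrix.B n).toCoxeterSystem.lift ⟨_, isLiftable_simpleReflection n⟩

theorem coxeterToSignedPerm_simple {n : ℕ} (i : Fin n) :
    coxeterToSignedPerm n ((CoxeterMatrix.B n).simple i) = SignedPerm.simpleReflection n i :=
  (CoxeterMatrix.B n).toCoxeterSystem.lift_apply_simple (isLiftable_simpleReflection n) i

theorem coxeterToSignedPerm_surjective (n : ℕ) [NeZero n] :
    Function.Surjective (coxeterToSignedPerm n) := by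
  rw [← MonoidHom.range_eq_top, eq_top_iff, ← SignedPerm.closure_range_simpleReflection,
    Subgroup.closure_le]
  rintro _ ⟨i, rfl⟩
  exact ⟨_, coxeterToSignedPerm_simple i⟩

variable {n : ℕ} [NeZero n]

/-- The points of `Fin n` counted from the last one, where the bond of order four is attached. -/
def pointFromEnd (n : ℕ) [NeZero n] (k : ℕ) : Fin n := Fin.rev (Fin.ofNat n k)

theorem val_pointFromEnd {k : ℕ} (hk : k < n) : (pointFromEnd n k : ℕ) = n - 1 - k := by
  rw [pointFromEnd, Fin.val_rev, Fin.val_ofNat, Nat.mod_eq_of_lt hk]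
  omega

theorem pointFromEnd_ne {i j : ℕ} (hij : i < j) (hj : j < n) :
    pointFromEnd n i ≠ pointFromEnd n j := by
  rw [ne_eq, Fin.ext_iff, val_pointFromEnd (hij.trans hj), val_pointFromEnd hj]
  omega

theorem coxeterMatrixB_pointFromEnd {i j : ℕ} (hij : i < j) (hj : j < n) :
    CoxeterMatrix.B n (pointFromEnd n j) (pointFromEnd n i) =
      if i + 1 = j then (if i = 0 then 4 else 3) else 2 := by
  have hi := val_pointFromEnd (hij.trans hj)
  rw [coxeterMatrixB_apply_of_lt (Fin.lt_def.2 (by rw [hi, val_pointFromEnd hj]; omega)), hi,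
    val_pointFromEnd hj]
  split_ifs <;> omega

theorem isTypeBFamily_simple (n : ℕ) [NeZero n] :
    IsTypeBFamily n fun k => (CoxeterMatrix.B n).simple (pointFromEnd n k) := by
  have hsq := (CoxeterMatrix.B n).toCoxeterSystem.simple_mul_simple_self
  have hrel := (CoxeterMatrix.B n).toCoxeterSystem.simple_mul_simple_pow
  simp only [CoxeterMatrix.toCoxeterSystem_simple] at hsq hrel
  have hinv := fun i => inv_eq_of_mul_eq_one_left (hsq i)
  refine ⟨fun i _ => hsq _, fun i j hij hj => ?_, fun i h0 hi => ?_, fun hn => ?_⟩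
  · have h := hrel (pointFromEnd n j) (pointFromEnd n i)
    rw [coxeterMatrixB_pointFromEnd (by omega) hj, if_neg (by omega), pow_two] at h
    rw [commute_iff_eq, ← mul_inv_eq_one, mul_inv_rev, hinv, hinv, ← inv_eq_one, ← h]
    simp only [mul_inv_rev, hinv, mul_assoc]
  · have h := hrel (pointFromEnd n (i + 1)) (pointFromEnd n i)
    rw [coxeterMatrixB_pointFromEnd (by omega) hi, if_pos rfl, if_neg h0.ne'] at h
    rw [← mul_inv_eq_one, ← inv_eq_one, ← h]
    simp only [mul_inv_rev, hinv, pow_succ, pow_zero, one_mul, mul_assoc]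
  · have h := hrel (pointFromEnd n (0 + 1)) (pointFromEnd n 0)
    rw [coxeterMatrixB_pointFromEnd (by omega) hn, if_pos rfl, if_pos rfl] at h
    rw [← mul_inv_eq_one, ← inv_eq_one, ← h]
    simp only [mul_inv_rev, hinv, pow_succ, pow_zero, one_mul, mul_assoc, zero_add]

theorem initialSubgroup_simple_eq_top (n : ℕ) [NeZero n] :
    initialSubgroup (fun k => (CoxeterMatrix.B n).simple (pointFromEnd n k)) n = ⊤ := by
  rw [eq_top_iff, ← (CoxeterMatrix.B n).toCoxeterSystem.subgroup_closure_range_simple]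
  refine Subgroup.closure_mono ?_
  rintro _ ⟨i, rfl⟩
  have hi : n - 1 - (i : ℕ) < n := by omega
  refine ⟨_, hi, ?_⟩
  rw [CoxeterMatrix.toCoxeterSystem_simple]
  exact congrArg _ (Fin.ext (by rw [val_pointFromEnd hi]; omega))

theorem coxeterToSignedPerm_simple_zero :
    coxeterToSignedPerm n ((CoxeterMatrix.B n).simple (pointFromEnd n 0)) =
      inl (Pi.mulSingle (pointFromEnd n 0) (-1)) := by
  have := NeZero.pos n
  rw [coxeterToSignedPerm_simple, SignedPerm.simpleReflection_of_add_one_eq_card]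
  rw [val_pointFromEnd this]
  omega

theorem coxeterToSignedPerm_simple_succ {k : ℕ} (hk : k + 1 < n) :
    coxeterToSignedPerm n ((CoxeterMatrix.B n).simple (pointFromEnd n (k + 1))) =
      inr (swap (pointFromEnd n (k + 1)) (pointFromEnd n k)) := by
  rw [coxeterToSignedPerm_simple, SignedPerm.simpleReflection_of_add_one_eq]
  rw [val_pointFromEnd hk, val_pointFromEnd (by omega)]
  omega

theorem coxeterToSignedPerm_injective (n : ℕ) [NeZero n] :
    Function.Injective (coxeterToSignedPerm n) := by
  have hsucc : ∀ k, k + 1 < n → ∀ i e, (SignedPerm.toPerm.comp (coxeterToSignedPerm n))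
      ((CoxeterMatrix.B n).simple (pointFromEnd n (k + 1))) (i, e) =
        (swap (pointFromEnd n (k + 1)) (pointFromEnd n k) i, e) := fun k hk i e => by
    rw [MonoidHom.comp_apply, coxeterToSignedPerm_simple_succ hk]
    simp [SignedPerm.toPerm_apply]
  have hzero : ∀ i e, (SignedPerm.toPerm.comp (coxeterToSignedPerm n))
      ((CoxeterMatrix.B n).simple (pointFromEnd n 0)) (i, e) =
        (i, (Pi.mulSingle (pointFromEnd n 0) (-1) : Fin n → ℤˣ) i * e) := fun i e => by
    rw [MonoidHom.comp_apply, coxeterToSignedPerm_simple_zero]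
    simp [SignedPerm.toPerm_apply]
  refine (injective_iff_map_eq_one _).2 fun w hw => ?_
  refine IsTypeBFamily.eq_one_of_map_eq_one (f := SignedPerm.toPerm.comp (coxeterToSignedPerm n))
    (x := fun k => (pointFromEnd n k, 1)) (y := fun k => (pointFromEnd n k, -1))
    ?_ ?_ ?_ ?_ ?_ ?_ (isTypeBFamily_simple n) le_rfl
    (initialSubgroup_simple_eq_top n ▸ Subgroup.mem_top w) (by simp [hw])
  · rw [hzero, Pi.mulSingle_eq_same, mul_one]
  · intro k hk
    rw [hsucc k hk, swap_apply_left]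
  · intro k hk
    rw [hsucc k hk, swap_apply_right]
  · intro i k hik hk
    cases i with
    | zero => rw [hzero, Pi.mulSingle_eq_of_ne (pointFromEnd_ne hik hk).symm, one_mul]
    | succ i =>
      rw [hsucc i (by omega), swap_apply_of_ne_of_ne (pointFromEnd_ne hik hk).symm
        (pointFromEnd_ne (by omega) hk).symm]
  · exact fun k hk h => pointFromEnd_ne (Nat.lt_succ_self k) hk (congrArg Prod.fst h)
  · exact fun k _ h => (show (1 : ℤˣ) ≠ -1 by decide) (congrArg Prod.snd h)

/-- The Coxeter group of type `B n` is the group of signed permutations of `Fin n`. -/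
noncomputable def coxeterEquivSignedPerm (n : ℕ) [NeZero n] :
    (CoxeterMatrix.B n).Group ≃* SignedPerm (Fin n) :=
  MulEquiv.ofBijective (coxeterToSignedPerm n)
    ⟨coxeterToSignedPerm_injective n, coxeterToSignedPerm_surjective n⟩

end CoxeterB

section BasePermutations

open Equiv

theorem swap_apply_mem {α : Type*} [DecidableEq α] {K : Subgroup (Perm α)} {g : Perm α}
    (hg : g ∈ K) {a b : α} (h : swap a b ∈ K) : swap (g a) (g b) ∈ K := by
  rw [swap_apply_apply]
  exact mul_mem (mul_mem hg h) (inv_mem hg)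

theorem eq_top_of_forall_swap_mem {α : Type*} [DecidableEq α] [Finite α] {K : Subgroup (Perm α)}
    (c : α) (h : ∀ a, swap a c ∈ K) : K = ⊤ := by
  rw [eq_top_iff, ← Perm.closure_isSwap, Subgroup.closure_le]
  rintro _ ⟨a, b, -, rfl⟩
  exact SubmonoidClass.swap_mem_trans _ (h a) (swap_comm c b ▸ h b)

/-- The permutation of `Fin n` given by a function on the natural numbers which restricts to an
involution of `{0, …, n - 1}`. -/
def involutivePerm (n : ℕ) (f : ℕ → ℕ) (hf : ∀ i < n, f i < n ∧ f (f i) = i) : Perm (Fin n) where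
  toFun i := ⟨f i, (hf i i.2).1⟩
  invFun i := ⟨f i, (hf i i.2).1⟩
  left_inv i := Fin.ext (hf i i.2).2
  right_inv i := Fin.ext (hf i i.2).2

theorem involutivePerm_mul_self {n : ℕ} {f : ℕ → ℕ} (hf : ∀ i < n, f i < n ∧ f (f i) = i) :
    involutivePerm n f hf * involutivePerm n f hf = 1 :=
  Perm.ext fun i => Fin.ext (hf i i.2).2

/-- The permutation `(a, a + 1)(a + 2, a + 3)⋯` of `Fin n`, which pairs neighbouring points from
`a` on; it fixes the last point if that is left without a partner. -/
def pairingFrom (n a : ℕ) : Perm (Fin n) :=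
  involutivePerm n (fun i => if i < a then i else if (i - a) % 2 = 1 then i - 1 else
    if i + 1 < n then i + 1 else i) <| by
    intro i hi
    split_ifs <;> omega

/-- The permutation `(0, k)(1, k + 1)⋯(k - 1, 2k - 1)` of `Fin n`, which exchanges the first two
blocks of `k` points when `2 * k ≤ n`. -/
def blockSwap (n k : ℕ) : Perm (Fin n) :=
  involutivePerm n (fun i => if i < k then (if i + k < n then i + k else i) else
    if i < 2 * k then i - k else i) <| by
    intro i hi
    split_ifs <;> omega

/-- The product `(0 1)(2 3)⋯ * (3 4)(5 6)⋯`. For odd `n` its cycles are `(0 1)` and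
`(2 3 5 ⋯ n-2 n-1 n-3 ⋯ 4)`. -/
def zigzag (n : ℕ) : Perm (Fin n) := pairingFrom n 0 * pairingFrom n 3

/-- The position of a point in the cycle `(2 3 5 ⋯ n-2 n-1 n-3 ⋯ 4)` of `zigzag n`. -/
def cyclePos (n i : ℕ) : ℕ :=
  if i % 2 = 1 then (i - 1) / 2 else if i = 2 then 0 else n - 2 - (i - 2) / 2

variable {n : ℕ}

theorem pairingFrom_apply (a : ℕ) (i : Fin n) : (pairingFrom n a i : ℕ) =
    if (i : ℕ) < a then (i : ℕ) else if (i - a : ℕ) % 2 = 1 then (i : ℕ) - 1 else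
      if (i : ℕ) + 1 < n then (i : ℕ) + 1 else i := rfl

theorem blockSwap_apply (k : ℕ) (i : Fin n) : (blockSwap n k i : ℕ) =
    if (i : ℕ) < k then (if (i : ℕ) + k < n then (i : ℕ) + k else i) else
      if (i : ℕ) < 2 * k then (i : ℕ) - k else i := rfl

theorem blockSwap_two_castLE (hn : 5 ≤ n) (i : Fin 5) :
    blockSwap n 2 (Fin.castLE hn i) = Fin.castLE hn ((swap 0 2 * swap 1 3 : Perm (Fin 5)) i) := by
  refine Fin.ext ?_
  rw [blockSwap_apply]
  fin_cases i <;> simp [swap_apply_def] <;> omega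

theorem commute_pairingFrom_zero_blockSwap_two (hn : 4 ≤ n) :
    Commute (pairingFrom n 0) (blockSwap n 2) := by
  refine Perm.ext fun i => Fin.ext ?_
  have := i.2
  simp only [Perm.mul_apply, pairingFrom_apply, blockSwap_apply]
  split_ifs <;> omega

theorem commute_pairingFrom_zero_blockSwap_one (n : ℕ) :
    Commute (pairingFrom n 0) (blockSwap n 1) := by
  refine Perm.ext fun i => Fin.ext ?_
  have := i.2
  simp only [Perm.mul_apply, pairingFrom_apply, blockSwap_apply]
  split_ifs <;> omega

theorem zigzag_pow_apply_of_lt (hn : 3 ≤ n) {i : Fin n} (hi : (i : ℕ) < 2) (k : ℕ) :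
    ((zigzag n ^ k) i : ℕ) = (i + k) % 2 := by
  induction k with
  | zero => rw [pow_zero, Perm.one_apply, add_zero, Nat.mod_eq_of_lt hi]
  | succ k ih =>
    rw [pow_succ', zigzag, Perm.mul_apply, Perm.mul_apply, pairingFrom_apply, pairingFrom_apply,
      ← zigzag, ih]
    split_ifs <;> omega

theorem eq_of_cyclePos_eq (hodd : Odd n) {i j : Fin n} (hi : 2 ≤ (i : ℕ)) (hj : 2 ≤ (j : ℕ))
    (h : (cyclePos n i : ZMod (n - 2)) = cyclePos n j) : i = j := by
  obtain ⟨m, rfl⟩ := hodd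
  have hlt : ∀ k : Fin (2 * m + 1), 2 ≤ (k : ℕ) → cyclePos (2 * m + 1) k < 2 * m + 1 - 2 := by
    intro k hk
    have := k.2
    simp only [cyclePos]
    split_ifs <;> omega
  rw [ZMod.natCast_eq_natCast_iff', Nat.mod_eq_of_lt (hlt i hi), Nat.mod_eq_of_lt (hlt j hj)] at h
  have := i.2
  have := j.2
  simp only [cyclePos] at h
  refine Fin.ext ?_
  split_ifs at h <;> omega

theorem two_le_zigzag_apply {i : Fin n} (hi : 2 ≤ (i : ℕ)) : 2 ≤ (zigzag n i : ℕ) := by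
  simp only [zigzag, Perm.mul_apply, pairingFrom_apply]
  split_ifs <;> omega

section Odd

variable (hodd : Odd n) (hn : 5 ≤ n)

include hodd hn

theorem cyclePos_zigzag_apply {i : Fin n} (hi : 2 ≤ (i : ℕ)) :
    (cyclePos n (zigzag n i) : ZMod (n - 2)) = cyclePos n i + 1 := by
  have hrot : (zigzag n i : ℕ) = if (i : ℕ) = 2 then 3 else if (i : ℕ) % 2 = 0 then (i : ℕ) - 2
      else if (i : ℕ) + 2 < n then (i : ℕ) + 2 else (i : ℕ) + 1 := by
    have := i.2
    obtain ⟨m, rfl⟩ := hodd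
    simp only [zigzag, Perm.mul_apply, pairingFrom_apply]
    split_ifs <;> omega
  have hpos : cyclePos n (zigzag n i) = cyclePos n i + 1 ∨
      cyclePos n (zigzag n i) + (n - 2) = cyclePos n i + 1 := by
    have := i.2
    obtain ⟨m, rfl⟩ := hodd
    rw [hrot]
    simp only [cyclePos]
    split_ifs <;> omega
  rw [← Nat.cast_add_one]
  rcases hpos with h | h
  · rw [h]
  · rw [← h, Nat.cast_add, ZMod.natCast_self, add_zero]

theorem cyclePos_zigzag_pow_apply {i : Fin n} (hi : 2 ≤ (i : ℕ)) (k : ℕ) :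
    2 ≤ ((zigzag n ^ k) i : ℕ) ∧
      (cyclePos n ((zigzag n ^ k) i) : ZMod (n - 2)) = cyclePos n i + k := by
  induction k with
  | zero => simpa using hi
  | succ k ih =>
    rw [pow_succ', Perm.mul_apply, cyclePos_zigzag_apply hodd hn ih.1, ih.2]
    exact ⟨two_le_zigzag_apply ih.1, by push_cast; ring⟩

theorem zigzag_pow_apply_eq_self_iff {i : Fin n} (hi : 2 ≤ (i : ℕ)) (k : ℕ) :
    (zigzag n ^ k) i = i ↔ n - 2 ∣ k := by
  obtain ⟨hle, hpos⟩ := cyclePos_zigzag_pow_apply hodd hn hi k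
  rw [← ZMod.natCast_eq_zero_iff]
  refine ⟨fun h => by simpa [h] using hpos.symm, fun h => eq_of_cyclePos_eq hodd hle hi ?_⟩
  rw [hpos, h, add_zero]

theorem exists_zigzag_pow_apply_eq {i : Fin n} (hi : 2 ≤ (i : ℕ)) :
    ∃ k, (zigzag n ^ k) (Fin.castLE hn 2) = i := by
  obtain ⟨hle, hpos⟩ := cyclePos_zigzag_pow_apply hodd hn (i := Fin.castLE hn 2) le_rfl
    (cyclePos n i)
  refine ⟨_, eq_of_cyclePos_eq hodd hle hi ?_⟩
  rw [hpos]
  simp [cyclePos]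

theorem zigzag_pow_eq_one_iff (k : ℕ) : zigzag n ^ k = 1 ↔ 2 * n - 4 ∣ k := by
  have hcop : Nat.Coprime 2 (n - 2) := by
    obtain ⟨m, rfl⟩ := hodd
    exact Nat.coprime_two_left.2 ⟨m - 1, by omega⟩
  have hpow := zigzag_pow_apply_of_lt (by omega : 3 ≤ n) (i := Fin.castLE hn 0) zero_lt_two k
  rw [show 2 * n - 4 = 2 * (n - 2) by omega]
  refine ⟨fun h => hcop.mul_dvd_of_dvd_of_dvd ?_ ?_, fun h => Perm.ext fun i => ?_⟩
  · simpa [h, Nat.dvd_iff_mod_eq_zero, eq_comm] using hpow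
  · rw [← zigzag_pow_apply_eq_self_iff hodd hn (i := Fin.castLE hn 2) le_rfl, h, Perm.one_apply]
  · rcases Nat.lt_or_ge (i : ℕ) 2 with hi | hi
    · obtain ⟨c, rfl⟩ := h
      refine Fin.ext ?_
      rw [zigzag_pow_apply_of_lt (by omega) hi, mul_assoc, Nat.add_mul_mod_self_left,
        Nat.mod_eq_of_lt hi, Perm.one_apply]
    · exact (zigzag_pow_apply_eq_self_iff hodd hn hi k).2 ((Dvd.intro_left _ rfl).trans h)

theorem orderOf_zigzag : orderOf (zigzag n) = 2 * n - 4 :=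
  Nat.dvd_antisymm
    (orderOf_dvd_of_pow_eq_one ((zigzag_pow_eq_one_iff hodd hn _).2 dvd_rfl))
    ((zigzag_pow_eq_one_iff hodd hn _).1 (pow_orderOf_eq_one _))

theorem zigzag_pow_eq_swap :
    zigzag n ^ (n - 2) = swap (Fin.castLE hn 0) (Fin.castLE hn 1) := by
  refine Perm.ext fun i => ?_
  rcases Nat.lt_or_ge (i : ℕ) 2 with hi | hi
  · refine Fin.ext ?_
    rw [zigzag_pow_apply_of_lt (by omega) hi]
    obtain ⟨m, rfl⟩ := hodd
    rcases (by omega : (i : ℕ) = 0 ∨ (i : ℕ) = 1) with h | h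
    · rw [h, (Fin.ext h : i = Fin.castLE hn 0), swap_apply_left, Fin.val_castLE, Fin.val_one]
      omega
    · rw [h, (Fin.ext h : i = Fin.castLE hn 1), swap_apply_right, Fin.val_castLE, Fin.val_zero]
      omega
  · rw [(zigzag_pow_apply_eq_self_iff hodd hn hi _).2 dvd_rfl, swap_apply_of_ne_of_ne] <;>
    · rintro rfl
      simp at hi

theorem eq_top_of_pairingFrom_mem {K : Subgroup (Perm (Fin n))} (h0 : pairingFrom n 0 ∈ K)
    (h3 : pairingFrom n 3 ∈ K) (hb : blockSwap n 2 ∈ K) : K = ⊤ := by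
  have hrot : zigzag n ∈ K := mul_mem h0 h3
  have h01 : swap (Fin.castLE hn 0) (Fin.castLE hn 1) ∈ K :=
    zigzag_pow_eq_swap hodd hn ▸ pow_mem hrot _
  have h23 : swap (Fin.castLE hn 2) (Fin.castLE hn 3) ∈ K := by
    have h := swap_apply_mem hb h01
    rwa [blockSwap_two_castLE, blockSwap_two_castLE] at h
  have hge : ∀ i : Fin n, 2 ≤ (i : ℕ) → swap i (Fin.castLE hn 2) ∈ K := by
    intro i hi
    obtain ⟨k, rfl⟩ := exists_zigzag_pow_apply_eq hodd hn hi
    have hr2 : zigzag n (Fin.castLE hn 2) = Fin.castLE hn 3 :=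
      Fin.ext (by simp [zigzag, pairingFrom_apply]; omega)
    clear hi
    induction k with
    | zero => exact swap_self (Fin.castLE hn 2) ▸ one_mem K
    | succ k ih =>
      refine SubmonoidClass.swap_mem_trans _ ?_ ih
      rw [pow_succ, Perm.mul_apply, hr2, swap_comm]
      exact swap_apply_mem (pow_mem hrot k) h23
  have h02 : swap (Fin.castLE hn 0) (Fin.castLE hn 2) ∈ K := by
    have h40 := swap_apply_mem hb (hge (Fin.castLE hn 4) (by simp))
    rw [blockSwap_two_castLE, blockSwap_two_castLE, swap_comm] at h40
    exact SubmonoidClass.swap_mem_trans _ h40 (hge (Fin.castLE hn 4) (by simp))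
  refine eq_top_of_forall_swap_mem (Fin.castLE hn 2) fun i => ?_
  rcases (by omega : (i : ℕ) = 0 ∨ (i : ℕ) = 1 ∨ 2 ≤ (i : ℕ)) with hi | hi | hi
  · exact (Fin.ext hi : i = Fin.castLE hn 0) ▸ h02
  · rw [(Fin.ext hi : i = Fin.castLE hn 1)]
    exact SubmonoidClass.swap_mem_trans _ (swap_comm (Fin.castLE hn 0) _ ▸ h01) h02
  · exact hge i hi

end Odd

end BasePermutations

section Facet

open Equiv SemidirectProduct

/-- The homomorphism from the group of signs which sends `-1` to the permutation `(5 6)(7 8)⋯`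
of the points beyond the first five. -/
def tailHom (n : ℕ) : ℤˣ →* Perm (Fin n) where
  toFun e := if e = 1 then 1 else pairingFrom n 5
  map_one' := if_pos rfl
  map_mul' a b := by
    rcases Int.units_eq_one_or a with rfl | rfl <;> rcases Int.units_eq_one_or b with rfl | rfl <;>
      simp [pairingFrom, involutivePerm_mul_self]

/-- The sign vector which is `-1` exactly at the points `1`, `3` and `4`. Conjugation by it
untwists the last three elements of the string to commuting sign changes and permutations. -/
def twist (i : ℕ) : ℤˣ := if i = 1 ∨ i = 3 ∨ i = 4 then -1 else 1

/-- The group of permutations of the first five points which preserve `twist`, that is, the set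
`{1, 3, 4}`. -/
def twistStabilizer : Subgroup (Perm (Fin 5)) where
  carrier := {g | ∀ i : Fin 5, twist (g i : Fin 5) = twist i}
  one_mem' _ := rfl
  mul_mem' hg hh i := (hg _).trans (hh i)
  inv_mem' {g} hg i := by rw [← hg, ← Perm.mul_apply, mul_inv_cancel, Perm.one_apply]

instance (g : Perm (Fin 5)) : Decidable (g ∈ twistStabilizer) :=
  inferInstanceAs (Decidable (∀ i : Fin 5, twist (g i : Fin 5) = twist i))

/-- The elements of `ℤˣ × Perm (Fin 5)` corresponding to the last three elements of the string. -/
def facetString : Fin 3 → ℤˣ × Perm (Fin 5) :=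
  ![(1, swap 3 4), (1, swap 0 2 * swap 1 3), (-1, swap 0 1)]

theorem twist_of_le {i : ℕ} (hi : 5 ≤ i) : twist i = 1 := if_neg (by omega)

section FacetString

theorem closure_range_facetString : Subgroup.closure (Set.range facetString) = ⊤ := by
  set L := Subgroup.closure (Set.range facetString)
  have hL : ∀ i, facetString i ∈ L := fun i => Subgroup.subset_closure ⟨i, rfl⟩
  have hconj : ∀ i a b, ((1, swap a b) : ℤˣ × Perm (Fin 5)) ∈ L →
      ((1, swap ((facetString i).2 a) ((facetString i).2 b)) : ℤˣ × Perm (Fin 5)) ∈ L := by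
    intro i a b h
    have hmem := mul_mem (mul_mem (hL i) h) (inv_mem (hL i))
    have hfst : (facetString i * (1, swap a b) * (facetString i)⁻¹).1 = 1 := by simp
    rwa [← Prod.mk.eta (p := facetString i * _ * _), hfst, Prod.snd_mul, Prod.snd_mul,
      Prod.snd_inv, ← swap_apply_apply] at hmem
  have h34 : ((1, swap 3 4) : ℤˣ × Perm (Fin 5)) ∈ L := hL 0
  have h14 : ((1, swap 1 4) : ℤˣ × Perm (Fin 5)) ∈ L := hconj 1 3 4 h34
  have h04 : ((1, swap 0 4) : ℤˣ × Perm (Fin 5)) ∈ L := hconj 2 1 4 h14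
  have h24 : ((1, swap 2 4) : ℤˣ × Perm (Fin 5)) ∈ L := hconj 1 0 4 h04
  have hinr : L.comap (MonoidHom.inr ℤˣ (Perm (Fin 5))) = ⊤ := by
    refine eq_top_of_forall_swap_mem 4 fun a => ?_
    fin_cases a
    exacts [h04, h14, h24, h34, (swap_self (4 : Fin 5)).symm ▸ one_mem L]
  have hone : ∀ g, ((1, g) : ℤˣ × Perm (Fin 5)) ∈ L := fun g =>
    Subgroup.mem_comap.1 (hinr ▸ Subgroup.mem_top g)
  refine eq_top_iff.2 fun ⟨e, g⟩ _ => ?_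
  rcases Int.units_eq_one_or e with rfl | rfl
  · exact hone g
  · have hmem := mul_mem (hL 2) (hone (swap 0 1 * g))
    rwa [show facetString 2 * (1, swap 0 1 * g) = (-1, g) from
      Prod.ext (mul_one _) (swap_mul_self_mul 0 1 g)] at hmem

theorem orderOf_facetString (i : Fin 3) : orderOf (facetString i) = 2 := by
  refine orderOf_eq_prime ?_ ?_ <;> revert i <;> decide

theorem hasSchlafliSymbol_facetString : HasSchlafliSymbol facetString ![6, 4] := by
  intro i
  fin_cases i
  · exact (orderOf_eq_iff (by norm_num)).2 (by decide)
  · exact (orderOf_eq_iff (by norm_num)).2 (by decide)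

set_option maxRecDepth 100000 in
theorem exists_eq_pow_mul_pow_of_mem_twistStabilizer : ∀ g ∈ twistStabilizer,
    ∃ k : Fin 6, ∃ e : Fin 2,
      (swap 3 4 * (swap 0 2 * swap 1 3)) ^ (k : ℕ) * swap 3 4 ^ (e : ℕ) = g := by
  decide

set_option maxRecDepth 100000 in
theorem eq_one_or_eq_swap_of_mem_twistStabilizer : ∀ g ∈ twistStabilizer,
    (∀ i : Fin 5, (g i : ℕ) < 2 ↔ (i : ℕ) < 2) → g = 1 ∨ g = swap 3 4 := by
  decide

set_option maxRecDepth 100000 in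
theorem eq_one_or_eq_mul_of_mem_twistStabilizer : ∀ g ∈ twistStabilizer,
    (∀ i j : Fin 5, (g i : ℕ) / 2 = (g j : ℕ) / 2 ↔ (i : ℕ) / 2 = (j : ℕ) / 2) →
    g = 1 ∨ g = swap 0 2 * swap 1 3 := by
  decide

set_option maxRecDepth 100000 in
theorem eq_one_and_mem_twistStabilizer : ∀ (e : ℤˣ) (g : Perm (Fin 5)),
    (∀ i : Fin 5, twist i * twist (g⁻¹ i : Fin 5) * e = 1) → e = 1 ∧ g ∈ twistStabilizer := by
  decide

theorem subgroupOn_facetString_zero_one : subgroupOn facetString {0, 1} =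
    twistStabilizer.map (MonoidHom.inr ℤˣ (Perm (Fin 5))) := by
  refine le_antisymm ((Subgroup.closure_le _).2 ?_) ?_
  · rintro _ ⟨i, rfl | rfl, rfl⟩
    · exact ⟨swap 3 4, (by decide : swap 3 4 ∈ twistStabilizer), rfl⟩
    · exact ⟨_, (by decide : swap 0 2 * swap 1 3 ∈ twistStabilizer), rfl⟩
  · rintro _ ⟨g, hg, rfl⟩
    obtain ⟨k, e, rfl⟩ := exists_eq_pow_mul_pow_of_mem_twistStabilizer g hg
    have h0 : facetString 0 ∈ subgroupOn facetString {0, 1} := mem_subgroupOn _ (by simp)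
    have h1 : facetString 1 ∈ subgroupOn facetString {0, 1} := mem_subgroupOn _ (by simp)
    rw [map_mul, map_pow, map_pow, map_mul]
    exact mul_mem (pow_mem (mul_mem h0 h1) _) (pow_mem h0 _)

theorem div_two_eq_iff_of_mem_subgroupOn {x : ℤˣ × Perm (Fin 5)}
    (hx : x ∈ subgroupOn facetString {1, 2}) (i j : Fin 5) :
    (x.2 i : ℕ) / 2 = (x.2 j : ℕ) / 2 ↔ (i : ℕ) / 2 = (j : ℕ) / 2 := by
  induction hx using Subgroup.closure_induction generalizing i j with
  | mem y hy =>
    obtain ⟨k, rfl | rfl, rfl⟩ := hy <;> revert i j <;> decide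
  | one => rfl
  | mul y z _ _ hy hz => exact (hy _ _).trans (hz i j)
  | inv y _ hy =>
    rw [← hy, ← Perm.mul_apply, ← Perm.mul_apply, ← Prod.snd_mul, mul_inv_cancel, Prod.snd_one,
      Perm.one_apply, Perm.one_apply]

theorem inf_subgroupOn_facetString_le :
    subgroupOn facetString {0, 1} ⊓ subgroupOn facetString {1, 2} ≤ subgroupOn facetString {1} := by
  rw [subgroupOn_facetString_zero_one]
  rintro _ ⟨⟨g, hg, rfl⟩, h12⟩
  rcases eq_one_or_eq_mul_of_mem_twistStabilizer g hg (div_two_eq_iff_of_mem_subgroupOn h12) with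
    rfl | rfl
  · exact map_one (MonoidHom.inr ℤˣ (Perm (Fin 5))) ▸ one_mem _
  · exact mem_subgroupOn facetString (i := 1) rfl

theorem isCString_facetString : IsCString facetString := by
  refine isCString_of_intervals orderOf_facetString closure_range_facetString
    (by unfold Commute SemiconjBy; decide) (by decide) fun a b hab => ?_
  obtain ⟨rfl, rfl⟩ : a = 0 ∧ b = 2 := by revert a b; decide
  have hIco : Set.Ico (0 : Fin 3) 2 = {0, 1} := by ext i; fin_cases i <;> simp
  have hIoc : Set.Ioc (0 : Fin 3) 2 = {1, 2} := by ext i; fin_cases i <;> simp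
  have hIoo : Set.Ioo (0 : Fin 3) 2 = {1} := by ext i; fin_cases i <;> simp
  rw [hIco, hIoc, hIoo]
  exact inf_subgroupOn_facetString_le

end FacetString

section FacetHom

variable {n : ℕ}

theorem tailHom_neg_one (n : ℕ) : tailHom n (-1) = pairingFrom n 5 := by
  change (if (-1 : ℤˣ) = 1 then 1 else pairingFrom n 5) = pairingFrom n 5
  exact if_neg (by decide)

theorem five_le_tailHom_apply (e : ℤˣ) {i : Fin n} (hi : 5 ≤ (i : ℕ)) :
    5 ≤ (tailHom n e i : ℕ) := by
  rcases Int.units_eq_one_or e with rfl | rfl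
  · rwa [map_one, Perm.one_apply]
  · rw [tailHom_neg_one, pairingFrom_apply]
    split_ifs <;> omega

variable (hn : 5 ≤ n)

/-- The permutations of the first five points of `Fin n`. -/
noncomputable def smallEmbed : Perm (Fin 5) →* Perm (Fin n) :=
  Perm.viaEmbeddingHom (Fin.castLEEmb hn)

theorem tailHom_castLE (e : ℤˣ) (i : Fin 5) :
    tailHom n e (Fin.castLE hn i) = Fin.castLE hn i := by
  rcases Int.units_eq_one_or e with rfl | rfl
  · rw [map_one, Perm.one_apply]
  · exact Fin.ext (by rw [tailHom_neg_one, pairingFrom_apply, if_pos (by simp)])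

theorem smallEmbed_castLE (g : Perm (Fin 5)) (i : Fin 5) :
    smallEmbed hn g (Fin.castLE hn i) = Fin.castLE hn (g i) :=
  Perm.viaEmbedding_apply g (Fin.castLEEmb hn) i

theorem smallEmbed_of_le (g : Perm (Fin 5)) {i : Fin n} (hi : 5 ≤ (i : ℕ)) :
    smallEmbed hn g i = i := by
  refine Perm.viaEmbedding_apply_of_notMem g (Fin.castLEEmb hn) i ?_
  rintro ⟨j, rfl⟩
  exact hi.not_gt j.2

theorem exists_eq_castLE_or_five_le (i : Fin n) :
    (∃ j, i = Fin.castLE hn j) ∨ 5 ≤ (i : ℕ) :=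
  (Nat.lt_or_ge (i : ℕ) 5).imp (fun h => ⟨⟨i, h⟩, rfl⟩) id

theorem perm_ext_castLE {g h : Perm (Fin n)}
    (hlt : ∀ j, g (Fin.castLE hn j) = h (Fin.castLE hn j))
    (hle : ∀ i : Fin n, 5 ≤ (i : ℕ) → (g i : ℕ) = h i) : g = h := by
  refine Perm.ext fun i => ?_
  rcases exists_eq_castLE_or_five_le hn i with ⟨j, rfl⟩ | hi
  · exact hlt j
  · exact Fin.ext (hle i hi)

theorem commute_smallEmbed_tailHom (g : Perm (Fin 5)) (e : ℤˣ) :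
    Commute (smallEmbed hn g) (tailHom n e) := by
  refine perm_ext_castLE hn (fun j => ?_) fun i hi => ?_
  · simp only [Perm.mul_apply, tailHom_castLE, smallEmbed_castLE]
  · rw [Perm.mul_apply, Perm.mul_apply, smallEmbed_of_le hn g hi,
      smallEmbed_of_le hn g (five_le_tailHom_apply e hi)]

/-- The permutation part of `facetHom`. -/
noncomputable def facetPerm : ℤˣ × Perm (Fin 5) →* Perm (Fin n) :=
  ((smallEmbed hn).noncommCoprod (tailHom n) (commute_smallEmbed_tailHom hn)).comp <|
    (MonoidHom.snd _ _).prod (MonoidHom.fst _ _ * Perm.sign.comp (MonoidHom.snd _ _))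

theorem facetPerm_apply (x : ℤˣ × Perm (Fin 5)) :
    facetPerm hn x = smallEmbed hn x.2 * tailHom n (x.1 * Perm.sign x.2) := rfl

theorem facetPerm_castLE (x : ℤˣ × Perm (Fin 5)) (i : Fin 5) :
    facetPerm hn x (Fin.castLE hn i) = Fin.castLE hn (x.2 i) := by
  rw [facetPerm_apply, Perm.mul_apply, tailHom_castLE, smallEmbed_castLE]

theorem facetPerm_of_le (x : ℤˣ × Perm (Fin 5)) {i : Fin n} (hi : 5 ≤ (i : ℕ)) :
    facetPerm hn x i = tailHom n (x.1 * Perm.sign x.2) i := by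
  rw [facetPerm_apply, Perm.mul_apply, smallEmbed_of_le hn _ (five_le_tailHom_apply _ hi)]

/-- The embedding of `ℤˣ × Perm (Fin 5)` with image the subgroup generated by the last three
elements of the string: `(e, g)` acts by `g` on the first five points and by the sign `e`,
conjugated by `twist`. -/
noncomputable def facetHom : ℤˣ × Perm (Fin 5) →* SignedPerm (Fin n) where
  toFun x := ⟨fun i => twist i * twist ((facetPerm hn x)⁻¹ i : Fin n) * x.1, facetPerm hn x⟩
  map_one' := by
    refine SemidirectProduct.ext (funext fun i => ?_) (map_one _)
    rw [map_one, inv_one]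
    exact (mul_one _).trans (Int.units_mul_self _)
  map_mul' x y := by
    refine SemidirectProduct.ext (funext fun i => ?_) (map_mul _ _ _)
    rw [SignedPerm.mul_left_apply]
    simp only [map_mul, mul_inv_rev, Perm.mul_apply, Prod.fst_mul]
    exact (by decide : ∀ a b c e f : ℤˣ, a * c * (e * f) = a * b * e * (b * c * f)) _ _ _ _ _

theorem facetHom_right (x : ℤˣ × Perm (Fin 5)) : (facetHom hn x).right = facetPerm hn x := rfl

theorem facetHom_left (x : ℤˣ × Perm (Fin 5)) (i : Fin n) :
    (facetHom hn x).left i = twist i * twist ((facetPerm hn x)⁻¹ i : Fin n) * x.1 := rfl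

theorem facetHom_left_castLE (x : ℤˣ × Perm (Fin 5)) (i : Fin 5) :
    (facetHom hn x).left (Fin.castLE hn i) = twist i * twist (x.2⁻¹ i : Fin 5) * x.1 := by
  rw [facetHom_left, ← map_inv, facetPerm_castLE]
  rfl

theorem facetHom_left_of_le (x : ℤˣ × Perm (Fin 5)) {i : Fin n} (hi : 5 ≤ (i : ℕ)) :
    (facetHom hn x).left i = x.1 := by
  rw [facetHom_left, ← map_inv, facetPerm_of_le hn _ hi, twist_of_le hi,
    twist_of_le (five_le_tailHom_apply _ hi), one_mul, one_mul]

theorem facetHom_injective : Function.Injective (facetHom hn) := by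
  refine (injective_iff_map_eq_one _).2 fun x hx => ?_
  have hperm : facetPerm hn x = 1 := by rw [← facetHom_right, hx, one_right]
  have hsnd : x.2 = 1 := Perm.ext fun i => Fin.castLE_injective hn <| by
    rw [← facetPerm_castLE, hperm, Perm.one_apply, Perm.one_apply]
  refine Prod.ext ?_ hsnd
  simpa [twist, hsnd, hx] using (facetHom_left_castLE hn x 0).symm

end FacetHom

/-- The images of the four generators in the group of signed permutations, when `i + 1` and
`n + i + 1` in `{1, …, 2n}` are labelled by the two signed points over `i : Fin n`. -/
def signedString (n : ℕ) : Fin 4 → SignedPerm (Fin n) :=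
  ![inr (pairingFrom n 0), inr (pairingFrom n 3), inr (blockSwap n 2),
    inl (fun i : Fin n => if (i : ℕ) < 2 then 1 else -1) * inr (blockSwap n 1)]

section SignedString

variable {n : ℕ} (hn : 5 ≤ n)

theorem facetPerm_facetString_zero (hodd : Odd n) :
    facetPerm hn (facetString 0) = pairingFrom n 3 := by
  obtain ⟨m, hm⟩ := hodd
  have hsign : (facetString 0).1 * Perm.sign (facetString 0).2 = -1 := by decide
  refine perm_ext_castLE hn (fun j => Fin.ext ?_) fun i hi => ?_
  · rw [facetPerm_castLE, pairingFrom_apply]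
    fin_cases j <;> (simp [facetString, swap_apply_def]; try omega)
  · rw [facetPerm_of_le hn _ hi, hsign, tailHom_neg_one, pairingFrom_apply, pairingFrom_apply]
    split_ifs <;> omega

theorem facetPerm_facetString_one : facetPerm hn (facetString 1) = blockSwap n 2 := by
  have hsign : (facetString 1).1 * Perm.sign (facetString 1).2 = 1 := by decide
  refine perm_ext_castLE hn (fun j => ?_) fun i hi => ?_
  · exact (facetPerm_castLE hn _ j).trans (blockSwap_two_castLE hn j).symm
  · rw [facetPerm_of_le hn _ hi, hsign, map_one, Perm.one_apply, blockSwap_apply,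
      if_neg (by omega), if_neg (by omega)]

theorem facetPerm_facetString_two : facetPerm hn (facetString 2) = blockSwap n 1 := by
  have hsign : (facetString 2).1 * Perm.sign (facetString 2).2 = 1 := by decide
  refine perm_ext_castLE hn (fun j => Fin.ext ?_) fun i hi => ?_
  · rw [facetPerm_castLE, blockSwap_apply]
    fin_cases j <;> (simp [facetString, swap_apply_def]; try omega)
  · rw [facetPerm_of_le hn _ hi, hsign, map_one, Perm.one_apply, blockSwap_apply,
      if_neg (by omega), if_neg (by omega)]

theorem facetHom_facetString_left (i : Fin 3) :
    (facetHom hn (facetString i)).left =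
      fun j : Fin n => if i = 2 then (if (j : ℕ) < 2 then (1 : ℤˣ) else -1) else 1 := by
  funext j
  rcases exists_eq_castLE_or_five_le hn j with ⟨j, rfl⟩ | hj
  · rw [facetHom_left_castLE, Fin.val_castLE]
    revert i j
    decide
  · rw [facetHom_left_of_le hn _ hj, if_neg (by omega : ¬(j : ℕ) < 2)]
    revert i
    decide

theorem facetHom_facetString (hodd : Odd n) (i : Fin 3) :
    facetHom hn (facetString i) = signedString n i.succ := by
  refine SemidirectProduct.ext ?_ ?_
  · rw [facetHom_facetString_left]
    fin_cases i
    · rfl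
    · rfl
    · simp [signedString]
  · rw [facetHom_right]
    fin_cases i
    · exact facetPerm_facetString_zero hn hodd
    · exact facetPerm_facetString_one hn
    · exact (facetPerm_facetString_two hn).trans (one_mul _).symm

end SignedString

end Facet

namespace SignedPerm

open Equiv SemidirectProduct

variable {α : Type*}

theorem commute_inr_inl {g : Perm α} {a : α → ℤˣ} (h : ∀ i, a (g i) = a i) :
    Commute (inr g : SignedPerm α) (inl a) := by
  have hinv : ∀ i, a (g⁻¹ i) = a i := fun i => by
    rw [← h (g⁻¹ i), ← Perm.mul_apply, mul_inv_cancel, Perm.one_apply]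
  have hconj := conj_inl g a
  rwa [funext hinv, mul_inv_eq_iff_eq_mul] at hconj

/-- The homomorphism from the signed permutations to the signs which counts the sign changes
modulo two. -/
def signProd [Fintype α] : SignedPerm α →* ℤˣ where
  toFun x := ∏ i, x.left i
  map_one' := Finset.prod_const_one
  map_mul' x y := by
    simp only [mul_left_apply, Finset.prod_mul_distrib]
    rw [Equiv.prod_comp x.right⁻¹ y.left]

theorem comp_mem_comap_inl {K : Subgroup (SignedPerm α)}
    (hK : ∀ (g : Perm α), ∀ x ∈ K, inr g * x * (inr g)⁻¹ ∈ K) (a : α → ℤˣ) (ha : a ∈ K.comap inl)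
    (g : Perm α) : a ∘ g ∈ K.comap inl := by
  have hconj := hK g⁻¹ _ (Subgroup.mem_comap.1 ha)
  rwa [conj_inl, inv_inv] at hconj

section SignVectors

variable {L : Subgroup (α → ℤˣ)} (hL : ∀ a ∈ L, ∀ g : Perm α, a ∘ g ∈ L) {a : α → ℤˣ} (ha : a ∈ L)
  {i j : α} (hij : a i ≠ a j)

include hL ha hij

theorem mulSingle_mul_mulSingle_mem [DecidableEq α] (k : α) :
    (Pi.mulSingle k (-1) * Pi.mulSingle i (-1) : α → ℤˣ) ∈ L := by
  have hne : i ≠ j := fun h => hij (congrArg a h)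
  have hprod : a i * a j = -1 := by
    rcases Int.units_eq_one_or (a i) with hi | hi <;>
      rcases Int.units_eq_one_or (a j) with hj | hj <;> simp_all
  have hpair : a * a ∘ swap i j = Pi.mulSingle j (-1) * Pi.mulSingle i (-1) := by
    funext l
    simp only [Pi.mul_apply, Function.comp_apply]
    rcases eq_or_ne l i with rfl | hi
    · rw [swap_apply_left, Pi.mulSingle_eq_of_ne hne, Pi.mulSingle_eq_same, one_mul, hprod]
    rcases eq_or_ne l j with rfl | hj
    · rw [swap_apply_right, Pi.mulSingle_eq_same, Pi.mulSingle_eq_of_ne hi, mul_one, mul_comm,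
        hprod]
    · rw [swap_apply_of_ne_of_ne hi hj, Pi.mulSingle_eq_of_ne hi, Pi.mulSingle_eq_of_ne hj,
        Int.units_mul_self, one_mul]
  rcases eq_or_ne k i with rfl | hki
  · rw [← Pi.mulSingle_mul, Int.units_mul_self, Pi.mulSingle_one]
    exact one_mem L
  · have hmem := hL _ (hpair ▸ mul_mem ha (hL a ha (swap i j))) (swap j k)
    convert hmem using 1
    funext l
    simp only [Pi.mul_apply, Function.comp_apply, Pi.mulSingle_apply, swap_apply_eq_iff,
      swap_apply_left, swap_apply_of_ne_of_ne hne hki.symm]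

theorem mem_of_prod_eq_one [Fintype α] {b : α → ℤˣ} (hb : ∏ k, b k = 1) : b ∈ L := by
  classical
  have hi : ∏ k, Pi.mulSingle i (b k) = (1 : α → ℤˣ) := by
    rw [← Pi.mulSingle_one i, ← hb]
    exact (map_prod (MonoidHom.mulSingle (fun _ : α => ℤˣ) i) b Finset.univ).symm
  have hsplit : b = ∏ k, (Pi.mulSingle k (b k) * Pi.mulSingle i (b k)) := by
    rw [Finset.prod_mul_distrib, Finset.univ_prod_mulSingle, hi, mul_one]
  rw [hsplit]
  refine Subgroup.prod_mem _ fun k _ => ?_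
  rcases Int.units_eq_one_or (b k) with hk | hk
  · rw [hk, Pi.mulSingle_one, Pi.mulSingle_one, one_mul]
    exact one_mem L
  · exact hk ▸ mulSingle_mul_mulSingle_mem hL ha hij k

end SignVectors

theorem eq_top_of_inl_mem [Fintype α] {K : Subgroup (SignedPerm α)} (hK : ∀ g, inr g ∈ K)
    {a b : α → ℤˣ} (ha : inl a ∈ K) {i j : α} (hij : a i ≠ a j) (hb : inl b ∈ K)
    (hprod : ∏ k, b k = -1) : K = ⊤ := by
  classical
  have hL := comp_mem_comap_inl fun g x hx => mul_mem (mul_mem (hK g) hx) (inv_mem (hK g))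
  have hmul : b * Pi.mulSingle i (-1) ∈ K.comap inl := by
    refine mem_of_prod_eq_one hL ha hij ?_
    simp only [Pi.mul_apply]
    rw [Finset.prod_mul_distrib, hprod, Finset.prod_pi_mulSingle']
    simp
  exact eq_top_of_inr_mem hK ((Subgroup.mul_mem_cancel_left (K.comap inl) hb).1 hmul)

end SignedPerm

section SignedString

open Equiv SemidirectProduct

variable {n : ℕ} (hodd : Odd n) (hn : 5 ≤ n)

theorem facetHom_neg_one_left : (facetHom hn (-1, 1)).left = fun _ => -1 := by
  funext i
  rcases exists_eq_castLE_or_five_le hn i with ⟨j, rfl⟩ | hi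
  · rw [facetHom_left_castLE]
    revert j
    decide
  · exact facetHom_left_of_le hn _ hi

theorem pairingFrom_apply_lt_two_iff {a : ℕ} (ha : a = 0 ∨ 2 ≤ a) (hn : 2 ≤ n) (i : Fin n) :
    (pairingFrom n a i : ℕ) < 2 ↔ (i : ℕ) < 2 := by
  rw [pairingFrom_apply]
  split_ifs <;> omega

include hodd

theorem subgroupOn_succ_image (J : Set (Fin 3)) :
    subgroupOn (signedString n) (Fin.succ '' J) =
      (subgroupOn facetString J).map (facetHom hn) := by
  rw [← subgroupOn_comp]
  simp only [facetHom_facetString hn hodd]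
  rw [subgroupOn, subgroupOn, Set.image_image]

theorem subgroupOn_one_two_three :
    subgroupOn (signedString n) {1, 2, 3} = (facetHom hn).range := by
  have himage : ({1, 2, 3} : Set (Fin 4)) = Fin.succ '' Set.univ := by
    simp [Set.ext_iff, Fin.forall_fin_succ]
  rw [himage, subgroupOn_succ_image hodd hn, subgroupOn, Set.image_univ,
    closure_range_facetString, MonoidHom.range_eq_map]

theorem mem_subgroupOn_one_two {x : SignedPerm (Fin n)} :
    x ∈ subgroupOn (signedString n) {1, 2} ↔ ∃ g ∈ twistStabilizer, facetHom hn (1, g) = x := by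
  have himage : ({1, 2} : Set (Fin 4)) = Fin.succ '' {0, 1} := by simp [Set.image_pair]
  rw [himage, subgroupOn_succ_image hodd hn, subgroupOn_facetString_zero_one, Subgroup.map_map]
  rfl

theorem subgroupOn_zero_one_two (hn : 5 ≤ n) :
    subgroupOn (signedString n) {0, 1, 2} = (inr : Perm (Fin n) →* SignedPerm (Fin n)).range := by
  refine le_antisymm ((Subgroup.closure_le _).2 ?_) ?_
  · rintro _ ⟨i, rfl | rfl | rfl, rfl⟩
    exacts [⟨_, rfl⟩, ⟨_, rfl⟩, ⟨_, rfl⟩]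
  · have htop : (subgroupOn (signedString n) {0, 1, 2}).comap inr = ⊤ :=
      eq_top_of_pairingFrom_mem hodd hn
        (mem_subgroupOn (signedString n) (by simp : (0 : Fin 4) ∈ _))
        (mem_subgroupOn (signedString n) (by simp : (1 : Fin 4) ∈ _))
        (mem_subgroupOn (signedString n) (by simp : (2 : Fin 4) ∈ _))
    rintro _ ⟨g, rfl⟩
    exact Subgroup.mem_comap.1 (htop ▸ Subgroup.mem_top g)

theorem orderOf_signedString (hn : 5 ≤ n) (i : Fin 4) : orderOf (signedString n i) = 2 := by
  refine Fin.cases ?_ (fun i => ?_) i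
  · refine (orderOf_injective inr inr_injective (pairingFrom n 0)).trans (orderOf_eq_prime ?_ ?_)
    · exact (pow_two _).trans (involutivePerm_mul_self _)
    · refine fun h => absurd (congrArg Fin.val (Perm.congr_fun h (Fin.castLE hn 0))) ?_
      rw [pairingFrom_apply]
      simp
      omega
  · rw [← facetHom_facetString hn hodd, orderOf_injective _ (facetHom_injective hn),
      orderOf_facetString]

theorem hasSchlafliSymbol_signedString (hn : 5 ≤ n) :
    HasSchlafliSymbol (signedString n) ![2 * n - 4, 6, 4] := by
  refine Fin.cases ?_ fun i => ?_
  · exact (orderOf_injective inr inr_injective (zigzag n)).trans (orderOf_zigzag hodd hn)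
  · rw [← Fin.succ_castSucc, ← facetHom_facetString hn hodd, ← facetHom_facetString hn hodd,
      ← map_mul, orderOf_injective _ (facetHom_injective hn), hasSchlafliSymbol_facetString]
    rfl

theorem signedString_commute (hn : 5 ≤ n) (i j : Fin 4)
    (hij : 2 ≤ |((i : ℕ) : ℤ) - ((j : ℕ) : ℤ)|) :
    Commute (signedString n i) (signedString n j) := by
  have h02 : Commute (signedString n 0) (signedString n 2) :=
    (commute_pairingFrom_zero_blockSwap_two (by omega)).map inr
  have h03 : Commute (signedString n 0) (signedString n 3) := by
    refine Commute.mul_right (SignedPerm.commute_inr_inl fun i => ?_)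
      ((commute_pairingFrom_zero_blockSwap_one n).map inr)
    simp only [pairingFrom_apply_lt_two_iff (Or.inl rfl) (by omega : 2 ≤ n)]
  have h13 : Commute (signedString n 1) (signedString n 3) := by
    have h := (isCString_facetString.commute 0 2 (by simp)).map (facetHom hn)
    rwa [facetHom_facetString hn hodd, facetHom_facetString hn hodd] at h
  fin_cases i <;> fin_cases j <;>
    first | exact absurd hij (by decide) | assumption | exact Commute.symm (by assumption)

theorem closure_range_signedString (hn : 5 ≤ n) :
    Subgroup.closure (Set.range (signedString n)) = ⊤ := by
  set K := Subgroup.closure (Set.range (signedString n))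
  have hle : ∀ J, subgroupOn (signedString n) J ≤ K := fun J =>
    Subgroup.closure_mono (Set.image_subset_range _ _)
  have hinr : ∀ g, inr g ∈ K := fun g =>
    hle {0, 1, 2} (subgroupOn_zero_one_two hodd hn ▸ ⟨g, rfl⟩)
  have hneg : inl (fun _ => -1) ∈ K := by
    have h : facetHom hn (-1, 1) ∈ K :=
      hle {1, 2, 3} (subgroupOn_one_two_three hodd hn ▸ ⟨_, rfl⟩)
    rw [← inl_left_mul_inr_right (facetHom hn (-1, 1)), facetHom_neg_one_left hn] at h
    exact (Subgroup.mul_mem_cancel_right _ (hinr _)).1 h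
  have hsign : inl (fun i : Fin n => if (i : ℕ) < 2 then (1 : ℤˣ) else -1) ∈ K :=
    (Subgroup.mul_mem_cancel_right _ (hinr _)).1 (Subgroup.subset_closure ⟨3, rfl⟩)
  refine SignedPerm.eq_top_of_inl_mem hinr hsign (i := Fin.castLE hn 0) (j := Fin.castLE hn 2)
    (by simp) hneg ?_
  rw [Finset.prod_const, Finset.card_univ, Fintype.card_fin, hodd.neg_one_pow]

omit hodd in
theorem apply_lt_two_iff_of_mem_subgroupOn (hn : 5 ≤ n) {x : SignedPerm (Fin n)}
    (hx : x ∈ subgroupOn (signedString n) {0, 1}) (i : Fin n) :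
    (x.right i : ℕ) < 2 ↔ (i : ℕ) < 2 := by
  induction hx using Subgroup.closure_induction generalizing i with
  | mem y hy =>
    obtain ⟨j, rfl | rfl, rfl⟩ := hy
    · exact pairingFrom_apply_lt_two_iff (Or.inl rfl) (by omega) i
    · exact pairingFrom_apply_lt_two_iff (Or.inr (by omega)) (by omega) i
  | one => rfl
  | mul y z _ _ hy hz => exact (hy _).trans (hz i)
  | inv y _ hy => rw [inv_right, ← hy, ← Perm.mul_apply, mul_inv_cancel, Perm.one_apply]

theorem inf_subgroupOn_zero_one_le (hn : 5 ≤ n) :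
    subgroupOn (signedString n) {0, 1} ⊓ subgroupOn (signedString n) {1, 2} ≤
      subgroupOn (signedString n) {1} := by
  rintro x ⟨h01, h12⟩
  obtain ⟨g, hg, rfl⟩ := (mem_subgroupOn_one_two hodd hn).1 h12
  have hlt : ∀ i : Fin 5, (g i : ℕ) < 2 ↔ (i : ℕ) < 2 := fun i => by
    have h := apply_lt_two_iff_of_mem_subgroupOn hn h01 (Fin.castLE hn i)
    rwa [facetHom_right, facetPerm_castLE] at h
  rcases eq_one_or_eq_swap_of_mem_twistStabilizer g hg hlt with rfl | rfl
  · exact map_one (facetHom hn) ▸ one_mem _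
  · exact (facetHom_facetString hn hodd 0).symm ▸ mem_subgroupOn (signedString n) rfl

theorem inf_subgroupOn_one_two_three_le (hn : 5 ≤ n) :
    subgroupOn (signedString n) {1, 2} ⊓ subgroupOn (signedString n) {2, 3} ≤
      subgroupOn (signedString n) {2} := by
  have h12 : ({1, 2} : Set (Fin 4)) = Fin.succ '' {0, 1} := by simp [Set.image_pair]
  have h23 : ({2, 3} : Set (Fin 4)) = Fin.succ '' {1, 2} := by simp [Set.image_pair]
  have h2 : ({2} : Set (Fin 4)) = Fin.succ '' {1} := by simp
  rw [h12, h23, h2, subgroupOn_succ_image hodd hn, subgroupOn_succ_image hodd hn,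
    subgroupOn_succ_image hodd hn, ← Subgroup.map_inf _ _ _ (facetHom_injective hn)]
  exact Subgroup.map_mono inf_subgroupOn_facetString_le

theorem inf_subgroupOn_zero_one_two_le (hn : 5 ≤ n) :
    subgroupOn (signedString n) {0, 1, 2} ⊓ subgroupOn (signedString n) {1, 2, 3} ≤
      subgroupOn (signedString n) {1, 2} := by
  rw [subgroupOn_zero_one_two hodd hn, subgroupOn_one_two_three hodd hn]
  rintro _ ⟨⟨p, hp⟩, ⟨⟨e, g⟩, rfl⟩⟩
  obtain ⟨rfl, hg⟩ := eq_one_and_mem_twistStabilizer e g fun i => by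
    rw [← facetHom_left_castLE hn (e, g), ← hp]
    rfl
  exact (mem_subgroupOn_one_two hodd hn).2 ⟨g, hg, rfl⟩

theorem signedString_injective (hn : 5 ≤ n) : Function.Injective (signedString n) := by
  have hzero : ∀ i : Fin 3, signedString n 0 ≠ signedString n i.succ := by
    intro i h
    have hfacet : ∀ i : Fin 3, ((facetString i).2 2 : ℕ) ≠ 3 := by decide
    have hpairing : (pairingFrom n 0 (Fin.castLE hn 2) : ℕ) = 3 := by
      rw [pairingFrom_apply]
      simp
      omega
    have hright : pairingFrom n 0 = facetPerm hn (facetString i) := by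
      rw [← facetHom_right, facetHom_facetString hn hodd, ← h]
      rfl
    rw [hright, facetPerm_castLE, Fin.val_castLE] at hpairing
    exact hfacet i hpairing
  have hsucc : Function.Injective fun i : Fin 3 => signedString n i.succ := by
    simp only [← facetHom_facetString hn hodd]
    exact (facetHom_injective hn).comp (by decide : Function.Injective facetString)
  exact Fin.cons_injective_iff.2 ⟨fun ⟨i, hi⟩ => hzero i hi.symm, hsucc⟩

theorem isCString_signedString (hn : 5 ≤ n) : IsCString (signedString n) := by
  refine isCString_of_intervals (orderOf_signedString hodd hn) (closure_range_signedString hodd hn)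
    (signedString_commute hodd hn) (signedString_injective hodd hn) fun a b hab => ?_
  have hcases : a = 0 ∧ b = 2 ∨ a = 1 ∧ b = 3 ∨ a = 0 ∧ b = 3 := by revert a b; decide
  rcases hcases with ⟨rfl, rfl⟩ | ⟨rfl, rfl⟩ | ⟨rfl, rfl⟩
  · convert inf_subgroupOn_zero_one_le hodd hn using 3 <;> ext i <;> fin_cases i <;> simp
  · convert inf_subgroupOn_one_two_three_le hodd hn using 3 <;> ext i <;> fin_cases i <;> simp
  · convert inf_subgroupOn_zero_one_two_le hodd hn using 3 <;> ext i <;> fin_cases i <;> simp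

end SignedString

section Quotients

open Equiv SemidirectProduct

namespace SignedPerm

open scoped commutatorElement

variable {α : Type*}

theorem inr_right_mem {K : Subgroup (SignedPerm α)} {x : SignedPerm α} (hx : x ∈ K)
    (hleft : inl x.left ∈ K) : inr x.right ∈ K := by
  rw [← inl_left_mul_inr_right x] at hx
  exact (Subgroup.mul_mem_cancel_left K hleft).1 hx

variable {K : Subgroup (SignedPerm α)} [K.Normal]

theorem mulSingle_mul_mulSingle_mem_of_normal [DecidableEq α] {x : SignedPerm α} (hx : x ∈ K)
    (i : α) :
    Pi.mulSingle (x.right i) (-1) * Pi.mulSingle i (-1) ∈ K.comap inl := by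
  set c : SignedPerm α := inl (Pi.mulSingle i (-1))
  have hconj : x * c * x⁻¹ = inl (Pi.mulSingle (x.right i) (-1)) := by
    rw [← conj_inl_mulSingle x.right]
    conv_lhs => rw [← inl_left_mul_inr_right x]
    rw [mul_inv_rev, ← mul_assoc, mul_assoc (inl _), mul_assoc (inl _), conj_inl_mulSingle,
      ← map_mul, ← map_inv, ← map_mul, mul_comm x.left, mul_inv_cancel_right]
  have hcomm : x * (c * x⁻¹ * c⁻¹) ∈ K := mul_mem hx (‹K.Normal›.conj_mem _ (inv_mem hx) c)
  rwa [← mul_assoc, ← mul_assoc, hconj, ← map_inv, ← map_mul, ← Pi.mulSingle_inv] at hcomm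

theorem inl_mem_of_normal [Fintype α] {a : α → ℤˣ} (ha : inl a ∈ K) {i j : α} (hij : a i ≠ a j)
    {b : α → ℤˣ} (hb : ∏ k, b k = 1) : inl b ∈ K :=
  mem_of_prod_eq_one (comp_mem_comap_inl fun g x hx => ‹K.Normal›.conj_mem x hx (inr g))
    (Subgroup.mem_comap.2 ha) hij hb

theorem alternatingGroup_le_comap_inr [Fintype α] [DecidableEq α] (hα : 5 ≤ Nat.card α)
    {x : SignedPerm α} (hx : x ∈ K) (hx1 : x.right ≠ 1) : alternatingGroup α ≤ K.comap inr := by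
  obtain ⟨i, hi⟩ : ∃ i, x.right i ≠ i := by
    contrapose! hx1
    exact Perm.ext hx1
  obtain ⟨k, hki, hkx⟩ : ∃ k, k ≠ i ∧ k ≠ x.right i := by
    refine Cardinal.exists_ne_ne_of_three_le ?_ _ _
    rw [← Nat.cast_card]
    exact_mod_cast (by omega : 3 ≤ Nat.card α)
  set g : Perm α := swap (x.right i) k
  have hxi : x.right (g i) = x.right i :=
    congrArg x.right (swap_apply_of_ne_of_ne hi.symm hki.symm)
  have hgx : g (x.right i) = k := swap_apply_left _ _
  have hcomm : ⁅x, inr g⁆ ∈ K :=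
    Subgroup.commutator_le_left K ⊤ (Subgroup.commutator_mem_commutator hx (Subgroup.mem_top _))
  have hprod : signProd ⁅x, inr g⁆ = 1 := by
    rw [map_commutatorElement, commutatorElement_eq_one_iff_mul_comm, mul_comm]
  have hleft : inl (⁅x, inr g⁆ : SignedPerm α).left ∈ K := by
    refine inl_mem_of_normal (mulSingle_mul_mulSingle_mem_of_normal hx i) (i := i) (j := k) ?_ hprod
    simp [hi.symm, hki, hkx]
  have hne : (⁅x, inr g⁆ : SignedPerm α).right ≠ 1 := by
    rw [← rightHom_eq_right, map_commutatorElement, rightHom_inr, Ne,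
      commutatorElement_eq_one_iff_mul_comm]
    exact fun h => hkx (hgx.symm.trans ((Perm.congr_fun h i).symm.trans hxi))
  refine Perm.alternatingGroup_le_of_normal hα ?_
  exact (Subgroup.nontrivial_iff_exists_ne_one _).2 ⟨_, inr_right_mem hcomm hleft, hne⟩

end SignedPerm

variable {n : ℕ}

theorem facetPerm_facetString_one_mem_alternatingGroup (hn : 5 ≤ n) :
    facetPerm hn (facetString 1) ∈ alternatingGroup (Fin n) := by
  have hsq : facetString 1 = (1, swap 0 1 * swap 1 2 * swap 2 3) ^ 2 := by decide
  rw [Perm.mem_alternatingGroup, hsq, map_pow, map_pow, Int.units_sq]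

variable (hodd : Odd n) (hn : 5 ≤ n) {Q : Type*} [Group Q] {f : SignedPerm (Fin n) →* Q}

section SignKernel

variable (h : IsCString fun i => f (signedString n i)) (hker : f.ker ≤ rightHom.ker)

include hodd h hker

theorem mem_twistStabilizer_of_mem_ker {x : ℤˣ × Perm (Fin 5)}
    (hx : inl (facetHom hn x).left ∈ f.ker) :
    x.2 ∈ twistStabilizer ∧ facetPerm hn (1, x.2) = facetPerm hn x := by
  have hfx : f (inr (facetPerm hn x)) = f (facetHom hn x) := by
    conv_rhs => rw [← inl_left_mul_inr_right (facetHom hn x), map_mul, MonoidHom.mem_ker.1 hx,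
      one_mul, facetHom_right]
  have hinter := h.inter {0, 1, 2} {1, 2, 3}
  have hset : ({0, 1, 2} ∩ {1, 2, 3} : Set (Fin 4)) = {1, 2} := by
    simp [Set.ext_iff, Fin.forall_fin_succ]
  rw [hset, subgroupOn_comp, subgroupOn_comp, subgroupOn_comp, subgroupOn_zero_one_two hodd hn,
    subgroupOn_one_two_three hodd hn] at hinter
  obtain ⟨y, hy, hyx⟩ : f (facetHom hn x) ∈ (subgroupOn (signedString n) {1, 2}).map f :=
    hinter ▸ ⟨⟨_, ⟨_, rfl⟩, hfx⟩, ⟨_, ⟨_, rfl⟩, rfl⟩⟩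
  obtain ⟨g, hg, rfl⟩ := (mem_subgroupOn_one_two hodd hn).1 hy
  have hperm : facetPerm hn (1, g) = facetPerm hn x :=
    (MonoidHom.eq_iff rightHom).2 (hker ((MonoidHom.eq_iff f).1 hyx))
  have hgx : g = x.2 := Perm.ext fun i => Fin.castLE_injective hn <| by
    rw [← facetPerm_castLE hn (1, g), ← facetPerm_castLE, hperm]
  exact ⟨hgx ▸ hg, hgx ▸ hperm⟩

theorem inl_neg_one_notMem_ker (hn : 5 < n) : inl (fun _ => -1) ∉ f.ker := by
  intro hmem
  rw [← facetHom_neg_one_left hn.le] at hmem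
  obtain ⟨-, hperm⟩ := mem_twistStabilizer_of_mem_ker hodd hn.le h hker hmem
  have hfix := congrArg Fin.val (Perm.congr_fun hperm ⟨5, hn⟩)
  have hfive : 5 ≤ ((⟨5, hn⟩ : Fin n) : ℕ) := le_rfl
  simp only [facetPerm_of_le hn.le _ hfive, mul_one, map_one, Perm.one_apply, tailHom_neg_one,
    pairingFrom_apply] at hfix
  obtain ⟨m, rfl⟩ := hodd
  split_ifs at hfix <;> omega

include hn

theorem eq_of_inl_mem_ker {a : Fin n → ℤˣ} (ha : inl a ∈ f.ker) (i j : Fin n) : a i = a j := by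
  by_contra hij
  have hprod : ∏ k, (facetHom hn (1, swap 0 1)).left k = 1 := by
    simp only [facetHom_left, mul_one, Finset.prod_mul_distrib]
    rw [Equiv.prod_comp (facetPerm hn (1, swap 0 1))⁻¹ fun i : Fin n => twist i,
      Int.units_mul_self]
  have hmem := SignedPerm.inl_mem_of_normal ha hij hprod
  exact absurd (mem_twistStabilizer_of_mem_ker hodd hn h hker hmem).1 (by decide)

end SignKernel

include hodd

theorem not_isCString_of_ker_ne_bot (hn : 5 < n) (hf : f.ker ≠ ⊥) :
    ¬ IsCString fun i => f (signedString n i) := by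
  intro h
  by_cases hker : f.ker ≤ rightHom.ker
  · obtain ⟨x, hx, hx1⟩ := f.ker.bot_or_exists_ne_one.resolve_left hf
    obtain ⟨a, rfl⟩ : x ∈ (inl : (Fin n → ℤˣ) →* SignedPerm (Fin n)).range :=
      range_inl_eq_ker_rightHom.ge (hker hx)
    obtain ⟨i, hi⟩ : ∃ i, a i ≠ 1 := by
      contrapose! hx1
      rw [show a = 1 from funext hx1, map_one]
    have ha : a = fun _ => -1 := funext fun j =>
      (eq_of_inl_mem_ker hodd hn.le h hker hx j i).trans ((Int.units_eq_one_or _).resolve_left hi)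
    exact inl_neg_one_notMem_ker hodd h hker hn (ha ▸ hx)
  · obtain ⟨x, hx, hx1⟩ := SetLike.not_le_iff_exists.1 hker
    have hmem : inr (blockSwap n 2) ∈ f.ker := facetPerm_facetString_one hn.le ▸
      SignedPerm.alternatingGroup_le_comap_inr (by simpa using hn.le) hx hx1
        (facetPerm_facetString_one_mem_alternatingGroup hn.le)
    have horder : orderOf (f (inr (blockSwap n 2))) = 2 := h.involution 2
    rw [MonoidHom.mem_ker.1 hmem, orderOf_one] at horder
    exact absurd horder (by decide)

theorem isUnravelledCString_map_signedString {G : Type*} [Group G] (hn : 5 < n)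
    (e : SignedPerm (Fin n) ≃* G) : IsUnravelledCString fun i => e (signedString n i) := by
  refine ⟨(isCString_signedString hodd hn.le).map e, fun N _ hN _ => ?_⟩
  refine isUnravelledAt_of_not_isCString (not_isCString_of_ker_ne_bot hodd
    (f := (QuotientGroup.mk' N).comp (e : SignedPerm (Fin n) →* G)) hn ?_)
  rwa [MonoidHom.ker_comp_mulEquiv, QuotientGroup.ker_mk', Ne,
    Subgroup.map_eq_bot_iff_of_injective _ e.symm.injective]

end Quotients

section Labelling

open Equiv SemidirectProduct

/-- The labelling of `{1, …, 2n}` by signed points: `(i, 1)` and `(i, -1)` label `i + 1` and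
`n + i + 1`. -/
def signedPointEquiv (n : ℕ) : Fin n × ℤˣ ≃ Omega n where
  toFun p := ⟨p.1 + 1 + if p.2 = 1 then 0 else n, by
    rw [Finset.mem_Icc]
    split_ifs <;> omega⟩
  invFun k := (⟨if (k : ℕ) ≤ n then k - 1 else k - n - 1, by
    have := Finset.mem_Icc.1 k.2
    split_ifs <;> omega⟩, if (k : ℕ) ≤ n then 1 else -1)
  left_inv := by
    rintro ⟨i, s⟩
    rcases Int.units_eq_one_or s with rfl | rfl <;> ext <;> simp
  right_inv k := by
    have := Finset.mem_Icc.1 k.2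
    by_cases hk : (k : ℕ) ≤ n <;> ext <;> simp [hk] <;> omega

variable {n : ℕ}

theorem signedPointEquiv_one (i : Fin n) : (signedPointEquiv n (i, 1) : ℕ) = i + 1 := rfl

theorem signedPointEquiv_neg_one (i : Fin n) :
    (signedPointEquiv n (i, -1) : ℕ) = i + 1 + n := rfl

theorem transp_apply {a b : ℕ} (ha : a ∈ Set.Icc 1 (2 * n)) (hb : b ∈ Set.Icc 1 (2 * n))
    (k : Omega n) :
    (transp n a b k : ℕ) = if (k : ℕ) = a then b else if (k : ℕ) = b then a else k := by
  rw [transp, dif_pos ⟨Finset.mem_Icc.2 ha, Finset.mem_Icc.2 hb⟩, swap_apply_def]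
  simp only [Subtype.ext_iff]
  split_ifs <;> rfl

theorem transp_mul_transp_add_apply {a : ℕ} (ha : 1 ≤ a) (han : a + 1 ≤ n) (k : Omega n) :
    ((transp n a (a + 1) * transp n (n + a) (n + a + 1)) k : ℕ) =
      if (k : ℕ) = a ∨ (k : ℕ) = n + a then (k : ℕ) + 1
      else if (k : ℕ) = a + 1 ∨ (k : ℕ) = n + a + 1 then (k : ℕ) - 1 else k := by
  rw [Perm.mul_apply, transp_apply (by grind) (by grind), transp_apply (by grind) (by grind)]
  split_ifs <;> omega

theorem prod_transp_pairs_apply {a : ℕ} (ha : 1 ≤ a) (m : ℕ) (hm : a + 2 * m ≤ n + 1)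
    (k : Omega n) :
    (((List.range m).map fun i => transp n (a + 2 * i) (a + 2 * i + 1) *
      transp n (n + (a + 2 * i)) (n + (a + 2 * i) + 1)).prod k : ℕ) =
      if a ≤ (k : ℕ) ∧ (k : ℕ) < a + 2 * m then
        if (k - a : ℕ) % 2 = 0 then (k : ℕ) + 1 else (k : ℕ) - 1
      else if n + a ≤ (k : ℕ) ∧ (k : ℕ) < n + a + 2 * m then
        if (k - n - a : ℕ) % 2 = 0 then (k : ℕ) + 1 else (k : ℕ) - 1
      else k := by
  induction m generalizing k with
  | zero =>
    rw [if_neg (by omega), if_neg (by omega)]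
    rfl
  | succ m ih =>
    rw [List.range_succ, List.map_append, List.prod_append, List.map_singleton,
      List.prod_singleton, Perm.mul_apply, ih (by omega)]
    have hk := transp_mul_transp_add_apply (a := a + 2 * m) (by omega) (by omega) k
    generalize (transp n (a + 2 * m) (a + 2 * m + 1) *
      transp n (n + (a + 2 * m)) (n + (a + 2 * m) + 1)) k = l at hk ⊢
    split_ifs at hk <;> rw [hk] <;> split_ifs <;> omega

theorem prod_transp_add_apply (m : ℕ) (hm : m + 2 ≤ n) (k : Omega n) :
    (((List.range' 1 m).map fun i => transp n (2 + i) (n + 2 + i)).prod k : ℕ) =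
      if 3 ≤ (k : ℕ) ∧ (k : ℕ) ≤ m + 2 then (k : ℕ) + n
      else if n + 3 ≤ (k : ℕ) ∧ (k : ℕ) ≤ n + m + 2 then (k : ℕ) - n else k := by
  induction m generalizing k with
  | zero =>
    rw [if_neg (by omega), if_neg (by omega)]
    rfl
  | succ m ih =>
    rw [List.range'_1_concat, List.map_append, List.prod_append, List.map_singleton,
      List.prod_singleton, Perm.mul_apply, ih (by omega), transp_apply (by grind) (by grind)]
    split_ifs <;> omega

theorem perm1_signedPointEquiv (hodd : Odd n) (hn : 2 ≤ n) (i : Fin n) (s : ℤˣ) :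
    perm1 n (signedPointEquiv n (i, s)) = signedPointEquiv n (pairingFrom n 0 i, s) := by
  obtain ⟨m, hm⟩ := hodd
  have hprod : perm1 n = ((List.range ((n - 2) / 2 + 1)).map fun i => transp n (1 + 2 * i)
      (1 + 2 * i + 1) * transp n (n + (1 + 2 * i)) (n + (1 + 2 * i) + 1)).prod :=
    congrArg List.prod (List.map_congr_left fun i _ => by congr 2 <;> omega)
  rw [Subtype.ext_iff, hprod, prod_transp_pairs_apply le_rfl _ (by omega)]
  rcases Int.units_eq_one_or s with rfl | rfl
  · rw [signedPointEquiv_one, signedPointEquiv_one, pairingFrom_apply]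
    split_ifs <;> omega
  · rw [signedPointEquiv_neg_one, signedPointEquiv_neg_one, pairingFrom_apply]
    split_ifs <;> omega

theorem perm2_signedPointEquiv (hodd : Odd n) (hn : 3 ≤ n) (i : Fin n) (s : ℤˣ) :
    perm2 n (signedPointEquiv n (i, s)) = signedPointEquiv n (pairingFrom n 3 i, s) := by
  obtain ⟨m, hm⟩ := hodd
  have hprod : perm2 n = ((List.range ((n - 3) / 2)).map fun i => transp n (4 + 2 * i)
      (4 + 2 * i + 1) * transp n (n + (4 + 2 * i)) (n + (4 + 2 * i) + 1)).prod := by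
    rw [perm2, List.range'_eq_map_range, List.map_map]
    exact congrArg List.prod (List.map_congr_left fun i _ => by
      rw [Function.comp_apply]
      congr 2 <;> omega)
  rw [Subtype.ext_iff, hprod, prod_transp_pairs_apply (by omega) _ (by omega)]
  rcases Int.units_eq_one_or s with rfl | rfl
  · rw [signedPointEquiv_one, signedPointEquiv_one, pairingFrom_apply]
    split_ifs <;> omega
  · rw [signedPointEquiv_neg_one, signedPointEquiv_neg_one, pairingFrom_apply]
    split_ifs <;> omega

theorem perm3_apply (hn : 4 ≤ n) (k : Omega n) : (perm3 n k : ℕ) =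
    if (k : ℕ) = 1 ∨ (k : ℕ) = 2 ∨ (k : ℕ) = n + 1 ∨ (k : ℕ) = n + 2 then (k : ℕ) + 2
    else if (k : ℕ) = 3 ∨ (k : ℕ) = 4 ∨ (k : ℕ) = n + 3 ∨ (k : ℕ) = n + 4 then (k : ℕ) - 2
    else k := by
  have hpair : ∀ {a : ℕ}, 1 ≤ a → a + 3 ≤ 2 * n → ∀ k : Omega n,
      ((transp n a (a + 2) * transp n (a + 1) (a + 3)) k : ℕ) =
        if (k : ℕ) = a ∨ (k : ℕ) = a + 1 then (k : ℕ) + 2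
        else if (k : ℕ) = a + 2 ∨ (k : ℕ) = a + 3 then (k : ℕ) - 2 else k := by
    intro a ha han k
    rw [Perm.mul_apply, transp_apply (by grind) (by grind), transp_apply (by grind) (by grind)]
    split_ifs <;> omega
  rw [perm3, mul_assoc, Perm.mul_apply, hpair le_rfl (by omega), hpair (a := n + 1) (by omega)
    (by omega)]
  split_ifs <;> omega

theorem perm3_signedPointEquiv (hn : 4 ≤ n) (i : Fin n) (s : ℤˣ) :
    perm3 n (signedPointEquiv n (i, s)) = signedPointEquiv n (blockSwap n 2 i, s) := by
  rw [Subtype.ext_iff, perm3_apply hn]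
  rcases Int.units_eq_one_or s with rfl | rfl
  · rw [signedPointEquiv_one, signedPointEquiv_one, blockSwap_apply]
    split_ifs <;> omega
  · rw [signedPointEquiv_neg_one, signedPointEquiv_neg_one, blockSwap_apply]
    split_ifs <;> omega

theorem perm4_apply (hn : 2 ≤ n) (k : Omega n) : (perm4 n k : ℕ) =
    if (k : ℕ) = 1 ∨ (k : ℕ) = n + 1 then (k : ℕ) + 1
    else if (k : ℕ) = 2 ∨ (k : ℕ) = n + 2 then (k : ℕ) - 1
    else if (k : ℕ) ≤ n then (k : ℕ) + n else (k : ℕ) - n := by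
  have := Finset.mem_Icc.1 k.2
  rw [perm4, Perm.mul_apply, Perm.mul_apply, transp_apply (by grind) (by grind),
    transp_apply (by grind) (by grind), prod_transp_add_apply _ (by omega)]
  split_ifs <;> omega

theorem perm4_signedPointEquiv (hn : 2 ≤ n) (i : Fin n) (s : ℤˣ) :
    perm4 n (signedPointEquiv n (i, s)) =
      signedPointEquiv n (blockSwap n 1 i, (if (blockSwap n 1 i : ℕ) < 2 then 1 else -1) * s) := by
  have hlt : (blockSwap n 1 i : ℕ) < 2 ↔ (i : ℕ) < 2 := by
    rw [blockSwap_apply]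
    split_ifs <;> omega
  rw [Subtype.ext_iff, perm4_apply hn]
  by_cases hi : (i : ℕ) < 2
  · rw [if_pos (hlt.2 hi), one_mul]
    rcases Int.units_eq_one_or s with rfl | rfl
    · rw [signedPointEquiv_one, signedPointEquiv_one, blockSwap_apply]
      split_ifs <;> omega
    · rw [signedPointEquiv_neg_one, signedPointEquiv_neg_one, blockSwap_apply]
      split_ifs <;> omega
  · rw [if_neg (mt hlt.1 hi)]
    rcases Int.units_eq_one_or s with rfl | rfl
    · rw [mul_one, signedPointEquiv_one, signedPointEquiv_neg_one, blockSwap_apply]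
      split_ifs <;> omega
    · rw [Int.units_mul_self, signedPointEquiv_one, signedPointEquiv_neg_one, blockSwap_apply]
      split_ifs <;> omega

theorem permString_signedPointEquiv (hodd : Odd n) (hn : 4 ≤ n) (i : Fin 4) (p : Fin n × ℤˣ) :
    permString n i (signedPointEquiv n p) =
      signedPointEquiv n (SignedPerm.toPerm (signedString n i) p) := by
  have hinr : ∀ g : Perm (Fin n), SignedPerm.toPerm (inr g) p = (g p.1, p.2) := fun g =>
    Prod.ext rfl (one_mul _)
  fin_cases i
  · exact (perm1_signedPointEquiv hodd (by omega) p.1 p.2).trans (congrArg _ (hinr _).symm)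
  · exact (perm2_signedPointEquiv hodd (by omega) p.1 p.2).trans (congrArg _ (hinr _).symm)
  · exact (perm3_signedPointEquiv hn p.1 p.2).trans (congrArg _ (hinr _).symm)
  · refine (perm4_signedPointEquiv (by omega) p.1 p.2).trans (congrArg _ ?_)
    change _ = SignedPerm.toPerm (inl _ * inr _) _
    rw [map_mul, Perm.mul_apply, hinr, SignedPerm.toPerm_apply]
    rfl

end Labelling

section Facets

open Equiv

variable {n : ℕ} (hodd : Odd n) (hn : 5 ≤ n)

include hodd hn

theorem nonempty_subgroupOn_zero_one_two_mulEquiv :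
    Nonempty (subgroupOn (signedString n) {0, 1, 2} ≃* Perm (Fin n)) :=
  ⟨(MulEquiv.subgroupCongr (subgroupOn_zero_one_two hodd hn)).trans
    (MonoidHom.ofInjective SemidirectProduct.inr_injective).symm⟩

theorem nonempty_subgroupOn_one_two_three_mulEquiv :
    Nonempty (subgroupOn (signedString n) {1, 2, 3} ≃*
      Multiplicative (ZMod 2) × Perm (Fin 5)) := by
  have hsign : ℤˣ ≃* Multiplicative (ZMod 2) := mulEquivOfPrimeCardEq (p := 2) (by simp) (by simp)
  exact ⟨(MulEquiv.subgroupCongr (subgroupOn_one_two_three hodd hn)).trans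
    ((MonoidHom.ofInjective (facetHom_injective hn)).symm.trans
      (hsign.prodCongr (MulEquiv.refl _)))⟩

end Facets

/-- For odd `n ≥ 5`, the Coxeter group of type `B_n` has a faithful permutation representation `φ`
on `Ω = {1, …, 2n}` whose image contains the four explicit permutations, and the corresponding
elements `t 0, t 1, t 2, t 3` form a C-string with Schläfli symbol `[2n - 4, 6, 4]`,
which is unravelled when `n > 5`. -/
theorem theorem1p2 (n : ℕ) (hodd : Odd n) (hn : 5 ≤ n) :
    ∃ (φ : (CoxeterMatrix.B n).Group →* Equiv.Perm (Omega n))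
      (t : Fin 4 → (CoxeterMatrix.B n).Group),
      Function.Injective φ ∧ (∀ i, φ (t i) = permString n i) ∧
      IsCString t ∧
      HasSchlafliSymbol t ![2 * n - 4, 6, 4] ∧
      Nonempty (subgroupOn t {0, 1, 2} ≃* Equiv.Perm (Fin n)) ∧
      Nonempty (subgroupOn t {1, 2, 3} ≃* Multiplicative (ZMod 2) × Equiv.Perm (Fin 5)) ∧
      (5 < n → IsUnravelledCString t) := by
  have : NeZero n := ⟨by omega⟩
  set e := (coxeterEquivSignedPerm n).symm
  obtain ⟨e012⟩ := nonempty_subgroupOn_zero_one_two_mulEquiv hodd hn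
  obtain ⟨e123⟩ := nonempty_subgroupOn_one_two_three_mulEquiv hodd hn
  refine ⟨((signedPointEquiv n).permCongrHom.toMonoidHom.comp SignedPerm.toPerm).comp
    e.symm.toMonoidHom, fun i => e (signedString n i), ?_, fun i => Equiv.Perm.ext fun k => ?_,
    (isCString_signedString hodd hn).map e, (hasSchlafliSymbol_signedString hodd hn).map e,
    ⟨(subgroupOnEquiv e _ _).symm.trans e012⟩, ⟨(subgroupOnEquiv e _ _).symm.trans e123⟩,
    fun hn' => isUnravelledCString_map_signedString hodd hn' e⟩
  · exact ((signedPointEquiv n).permCongrHom.injective.comp SignedPerm.toPerm_injective).comp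
      e.symm.injective
  · obtain ⟨p, rfl⟩ := (signedPointEquiv n).surjective k
    rw [permString_signedPointEquiv hodd (by omega)]
    simp
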